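/- Let $\mathcal X$ be a measurable space, $\mathcal T\subset\mathbb R$, and $\mathcal H$ a non-empty class of measurable classifiers $h:\mathcal X\to\{0,1\}$. A drift process $(p_t,P_T)$ consists of a probability measure $P_T$ on $\mathcal T$ and a Markov kernel $p$ from $\mathcal T$ to $\mathcal X$. A window of size $n$ is an i.i.d. sample $S=((t_i,x_i))_{i\le n}$ with $t_i\sim P_T$ and $x_i\sim p_{t_i}$ given $t_i$. There is drift if $(P_T\otimes P_T)\{(s,t): p_s\ne p_t\}>0$. An estimator is a family of measurable maps $(S,t)\mapsto \hat d(S,t)\in\mathbb R$, one for each window size; it detects drift on $S$ if $\hat d(S,t)>0$ for some $t\in\mathcal T$. - $\hat d$ is surely drift detecting if for every drift process and every $0<\delta<1$ there is $n_0$ such that for every $n>n_0$, with probability at least $1-\delta$ over windows $S$ of size $n$, drift is detected on $S$ if and only if there is drift. - $\hat d$ is precise if for every drift process with a single abrupt drift event at $t_0$ ($p_t=P$ for $t\le t_0$, $p_t=Q$ for $t>t_0$, $P\neq Q$, $0<P_T((-\infty,t_0])<1$) and all $0<\delta<1$, $\epsilon>0$ there is $n_0$ such that for every $n>n_0$, with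 probability at least $1-\delta$ over windows $S$ of size $n$: if drift is detected on $S$, then $\hat d(S,\cdot)$ attains its maximum over $\mathcal T$, and each maximizer $\hat t_0$ has precision $1-P_T\big((t_0,\hat t_0]\cup(\hat t_0,t_0]\big)>1-\epsilon$. For a task $(X,Y)$ with $Y\in\{0,1\}$ let $\ell_w(y',(x,y))=\frac1{2\,\mathbb P[Y=y]}$ if $y'\ne y$ and $0$ otherwise. For a window $S$ of size $n$ and $t\in\mathcal T$ consider the task of predicting $Y=\mathbf 1[T>t]$ from $X$, let $\hat R_{S,t}(h)$ be the empirical $\ell_w$-risk of $h$ on $S$ in this task, with the class probabilities replaced by the relative frequencies in $S$, and put $$\hat D(S,t)=\tfrac12-\inf_{h\in\mathcal H}\hat R_{S,t}(h),\qquad \hat F(t)=\tfrac1n|\{i: t_i\le t\}| .$$ Assume that $\hat D$ is an estimator, i.e. measurable. Let $\tau_n,\varepsilon_n>0$ be any sequences with $\tau_n\to0$, $\varepsilon_n\to0$ and $\varepsilon_n\tau_n\sqrt{n/\log n}\to\infty$, and let $$\hat d(S,t)=\begin{cases}\max(\hat D(S,t)-\varepsilon_n,0), & \tau_n\le \hat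 F(t)<1-\tau_n,\\ 0,&\text{otherwise.}\end{cases}$$ If $\mathcal H$ is PAC-learnable, then $\hat d$ is an estimator and it is precise. If in addition for every probability distribution of $(X,Y)$ on $\mathcal X\times\{0,1\}$ with $X$ and $Y$ not independent there is $h\in\mathcal H$ that is better than random, i.e. $\mathbb E[\ell_w(h(X),(X,Y))]<\frac12$, then $\hat d$ is also surely drift detecting. -/

import Mathlib

open MeasureTheory ProbabilityTheory Filter Topology
open scoped ENNReal

namespace DriftDetection

noncomputable section

/-- A family of real-valued statistics of a window `S` of `n` time-stamped observations and of a
split point `t`; this is the composition of the descriptor map and the similarity map. -/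
abbrev Statistic (X : Type*) (𝒯 : Set ℝ) : Type _ :=
  ∀ n : ℕ, (Fin n → 𝒯 × X) → 𝒯 → ℝ

/-- An estimator is a statistic that is (jointly) measurable in the window and the split point. -/
def IsEstimator {X : Type*} [MeasurableSpace X] {𝒯 : Set ℝ} (d : Statistic X 𝒯) : Prop :=
  ∀ n : ℕ, Measurable fun z : (Fin n → 𝒯 × X) × 𝒯 => d n z.1 z.2

/-! ### Drift processes and windows -/

/-- The law of a window of size `n`: an i.i.d. sample of pairs `(T, X)` with `T ∼ P_T` and
`X ∼ p_T` given `T`. -/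
def windowLaw {X : Type*} [MeasurableSpace X] {𝒯 : Set ℝ} (PT : Measure 𝒯) (p : Kernel 𝒯 X)
    (n : ℕ) : Measure (Fin n → 𝒯 × X) :=
  Measure.pi fun _ => PT ⊗ₘ p

/-- There is drift: with positive probability, `p` takes different values at two independent
arrival times. -/
def HasDrift {X : Type*} [MeasurableSpace X] {𝒯 : Set ℝ} (PT : Measure 𝒯) (p : Kernel 𝒯 X) :
    Prop :=
  0 < (PT.prod PT) {s | p s.1 ≠ p s.2}

/-- There is one single abrupt drift event, at time `t₀`. -/
def IsSingleAbruptDrift {X : Type*} [MeasurableSpace X] {𝒯 : Set ℝ} (p : Kernel 𝒯 X) (t₀ : 𝒯) :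
    Prop :=
  ∃ P Q : Measure X, P ≠ Q ∧ (∀ t, t ≤ t₀ → p t = P) ∧ (∀ t, t₀ < t → p t = Q)

/-! ### Properties of estimators -/

/-- The estimator `d` raises an alarm on the window `S`. -/
def Detects {X : Type*} {𝒯 : Set ℝ} (d : Statistic X 𝒯) {n : ℕ} (S : Fin n → 𝒯 × X) : Prop :=
  ∃ t, 0 < d n S t

/-- For every sufficiently large window, up to probability `δ`, an alarm is raised if and only if
there is drift. -/
def RaisesCorrectAlarms {X : Type*} [MeasurableSpace X] {𝒯 : Set ℝ} (d : Statistic X 𝒯)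
    (PT : Measure 𝒯) (p : Kernel 𝒯 X) (δ : ℝ) : Prop :=
  ∃ n₀ : ℕ, ∀ n, n₀ < n →
    windowLaw PT p n {S | ¬ (Detects d S ↔ HasDrift PT p)} ≤ ENNReal.ofReal δ

/-- `d` is surely drift detecting, for every drift process on `X` and `𝒯`. -/
def IsSurelyDriftDetecting {X : Type*} [MeasurableSpace X] {𝒯 : Set ℝ} (d : Statistic X 𝒯) :
    Prop :=
  ∀ (PT : Measure 𝒯) [IsProbabilityMeasure PT] (p : Kernel 𝒯 X) [IsMarkovKernel p],
    ∀ δ : ℝ, 0 < δ → δ < 1 → RaisesCorrectAlarms d PT p δ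

/-- `t` maximizes the estimated dissimilarity of the two sub-windows of `S`. -/
def IsDriftPointEstimate {X : Type*} {𝒯 : Set ℝ} (d : Statistic X 𝒯) {n : ℕ}
    (S : Fin n → 𝒯 × X) (t : 𝒯) : Prop :=
  ∀ t', d n S t' ≤ d n S t

/-- One minus the probability of arriving between the drift event `t₀` and its estimate `t`;
`Set.uIoc t₀ t` is `(t₀, t]` or `(t, t₀]`, that is, the set of the arrival times which the splits
at `t₀` and at `t` put on different sides. -/
def precision {𝒯 : Set ℝ} (PT : Measure 𝒯) (t₀ t : 𝒯) : ℝ :=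
  1 - PT.real (Set.uIoc t₀ t)

/-- `d` is precise, for every drift process on `X` and `𝒯` with a single abrupt drift event:
up to probability `δ`, if an alarm is raised, then a maximizer exists and every maximizer
has precision larger than `1 - ε`. -/
def IsPrecise {X : Type*} [MeasurableSpace X] {𝒯 : Set ℝ} (d : Statistic X 𝒯) : Prop :=
  ∀ (PT : Measure 𝒯) [IsProbabilityMeasure PT] (p : Kernel 𝒯 X) [IsMarkovKernel p] (t₀ : 𝒯),
    IsSingleAbruptDrift p t₀ → 0 < PT (Set.Iic t₀) → PT (Set.Iic t₀) < 1 →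
    ∀ δ ε : ℝ, 0 < δ → δ < 1 → 0 < ε →
      ∃ n₀ : ℕ, ∀ n, n₀ < n →
        windowLaw PT p n {S | ¬ (Detects d S →
          (∃ t, IsDriftPointEstimate d S t) ∧
            ∀ t, IsDriftPointEstimate d S t → 1 - ε < precision PT t₀ t)} ≤ ENNReal.ofReal δ

/-! ### Learning -/

/-- PAC-learnability (realizable case) of a class of binary classifiers: a learner that sees `m`
i.i.d. points labelled by an unknown target `c ∈ H` returns, up to probability `δ`, a classifier
(which need not lie in `H`) of error at most `ε`, as soon as `m ≥ N ε δ`. -/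
def IsPACLearnable {X : Type*} [MeasurableSpace X] (H : Set (X → Bool)) : Prop :=
  ∃ (A : ∀ m : ℕ, (Fin m → X × Bool) → X → Bool) (N : ℝ → ℝ → ℕ),
    ∀ ε δ : ℝ, 0 < ε → ε < 1 → 0 < δ → δ < 1 →
      ∀ (P : Measure X) [IsProbabilityMeasure P], ∀ c ∈ H, ∀ m, N ε δ ≤ m →
        (Measure.pi fun _ : Fin m => P)
          {x | ENNReal.ofReal ε < P {z | A m (fun i => (x i, c (x i))) z ≠ c z}}
            ≤ ENNReal.ofReal δ

/-- The 0-1-loss of predicting `b` for the label `y`, reweighted by the class probabilities `π`.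
It is normalized such that guessing at random has expected loss `1 / 2`. -/
def weightedLoss (π : Bool → ℝ) (b y : Bool) : ℝ :=
  if b ≠ y then 1 / (2 * π y) else 0

/-- The class-reweighted risk of the classifier `h` in the binary classification task with
joint distribution `D` of features and labels. -/
def weightedRisk {X : Type*} [MeasurableSpace X] (D : Measure (X × Bool)) (h : X → Bool) : ℝ :=
  ∫ z, weightedLoss (fun y => D.real {w | w.2 = y}) (h z.1) z.2 ∂D

/-- In every binary classification task on `X` in which the features carry information on the
label, some `h ∈ H` performs better than random. -/
def BetterThanRandom {X : Type*} [MeasurableSpace X] (H : Set (X → Bool)) : Prop :=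
  ∀ (D : Measure (X × Bool)) [IsProbabilityMeasure D],
    ¬ IndepFun (Prod.fst : X × Bool → X) (Prod.snd : X × Bool → Bool) D →
      ∃ h ∈ H, weightedRisk D h < 1 / 2

/-! ### The estimators induced by a hypothesis class -/

/-- The label `𝟏[s ∈ W₊(t)]`. -/
def afterLabel {𝒯 : Set ℝ} (t s : 𝒯) : Bool := decide (t < s)

/-- The relative frequency in the window `S` of the label `y` for the split at `t`. -/
def labelFreq {X : Type*} {𝒯 : Set ℝ} {n : ℕ} (S : Fin n → 𝒯 × X) (t : 𝒯) (y : Bool) : ℝ :=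
  ((Finset.univ.filter fun i => afterLabel t (S i).1 = y).card : ℝ) / n

/-- The empirical class-reweighted risk of `h` for predicting `𝟏[T ∈ W₊(t)]` from `X`. -/
def empiricalRisk {X : Type*} {𝒯 : Set ℝ} {n : ℕ} (S : Fin n → 𝒯 × X) (t : 𝒯)
    (h : X → Bool) : ℝ :=
  (1 / (n : ℝ)) * ∑ i, weightedLoss (labelFreq S t) (h (S i).2) (afterLabel t (S i).1)

/-- The plug-in statistic `1/2 - inf_{h ∈ H}` of the empirical class-reweighted risk. -/
def plugIn {X : Type*} (H : Set (X → Bool)) (𝒯 : Set ℝ) : Statistic X 𝒯 :=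
  fun _ S t => 1 / 2 - ⨅ h : H, empiricalRisk S t h

/-- The estimator induced by `H`: the amount by which the plug-in statistic exceeds the threshold
`ε n`, at the split points `t` with `τ n ≤ |S₋(t)| / n < 1 - τ n`, and `0` at the other ones. -/
def inducedEstimator {X : Type*} (H : Set (X → Bool)) (𝒯 : Set ℝ) (τ ε : ℕ → ℝ) :
    Statistic X 𝒯 :=
  fun n S t =>
    if τ n ≤ labelFreq S t false ∧ labelFreq S t false < 1 - τ n then
      max (plugIn H 𝒯 n S t - ε n) 0
    else 0

end

end DriftDetection

namespace DriftDetection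

/-! Once the two sides of a split are reweighted to equal mass, `1/2` minus the risk of `h` is half
the difference between the mean of `h` after the split and its mean up to it. Both claims therefore
reduce to controlling such mean differences, from above uniformly over all `h ∈ H` and all
admissible splits, from below for one well-chosen `h` and `t`.

Upper bound. PAC-learnability forces finite VC dimension (no free lunch), so `H` has polynomially
many traces on a sample (Sauer-Shelah). Symmetrization with a ghost sample and a Chernoff bound give
the deviation inequality `measure_exists_deviation_le`. It is applied conditionally on the arrival
times, when the observations are independent but not identically distributed, and a union bound runs
over the at most `n` essentially different splits. The rate condition makes the error at most `ε n /
2`. For a process with phases `P` and `Q` around `t₀`, the result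
`eventually_windowLaw_lt_plugIn_le` bounds the statistic at `t` by `(1 - mismatch) * Δ + ε n / 2`,
where `Δ ≥ 0` bounds the discrepancy of the phases as seen by `H`.

Precision. If `Δ = 0`, then with high probability no alarm is raised. If `Δ > 0`, the law of large
numbers makes the statistic at `t₀` nearly `Δ`, so a maximizer must have small empirical mismatch
with `t₀`; this passes to small `P_T`-mass between them because all far splits share one common set
of large mass.

Sure detection. Without drift the upper bound applies with `P = Q` and `Δ = 0`. If time and
observation are dependent, then so are the observation and the label of some split, and a
better-than-random `h` raises the alarm there. What remains is drift with time and observation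
independent, conceivable because the σ-algebra on `X` may lack a countable generator, so that null
sets depending on the event need not combine. This is excluded by contradiction: at almost every
pair of times, the process living on these two times only has the same alarm probabilities as a
driftless one, although at some such pair it is a dependent process which must raise alarms. -/

/-! ### PAC-learnability, VC dimension and the number of traces. -/

/-- Every choice of labels for the points `x` is realized by the class `H`. -/
def ShattersPoints {X ι : Type*} (H : Set (X → Bool)) (x : ι → X) : Prop :=
  ∀ b : ι → Bool, ∃ h ∈ H, ∀ i, h (x i) = b i

/-- Flipping `c z` exchanges wrong and right labelings, since `f` does not see `c z`. In the
application `f c` is the prediction at a point `z` outside the training sample. -/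
theorem card_wrong_labelings {α : Type*} [Fintype α] [DecidableEq α] (f : (α → Bool) → Bool) (z : α)
    (hf : ∀ c b, f (Function.update c z b) = f c) :
    2 * (Finset.univ.filter fun c : α → Bool => f c ≠ c z).card = 2 ^ Fintype.card α := by
  classical
  have h1 : (Finset.univ.filter fun c : α → Bool => f c ≠ c z).card
      = (Finset.univ.filter fun c : α → Bool => ¬ f c ≠ c z).card := by
    refine Finset.card_bij' (fun c _ => Function.update c z (!c z))
      (fun c _ => Function.update c z (!c z)) ?_ ?_ ?_ ?_
    · intro c hc
      simp only [Finset.mem_filter, Finset.mem_univ, true_and, hf, Function.update_self] at hc ⊢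
      cases h1 : f c <;> cases h2 : c z <;> simp_all
    · intro c hc
      simp only [Finset.mem_filter, Finset.mem_univ, true_and, hf, Function.update_self] at hc ⊢
      cases h1 : f c <;> cases h2 : c z <;> simp_all
    · intro c _; simp
    · intro c _; simp
  have h2 := Finset.card_filter_add_card_filter_not (s := (Finset.univ : Finset (α → Bool)))
    (fun c => f c ≠ c z)
  rw [← h1, Finset.card_univ, Fintype.card_fun, Fintype.card_bool] at h2
  omega

/-- Averaging form of the no-free-lunch theorem. -/
theorem exists_labeling_with_large_error {α : Type*} [Fintype α] [DecidableEq α] {m : ℕ}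
    (hm : 2 * m ≤ Fintype.card α) (B : (Fin m → α × Bool) → α → Bool) :
    ∃ c : α → Bool, Fintype.card α * Fintype.card α ^ m ≤
      4 * ∑ x : Fin m → α, (Finset.univ.filter fun z => B (fun i => (x i, c (x i))) z ≠ c z).card := by
  classical
  by_contra! hcon
  have hx : ∀ x : Fin m → α, Fintype.card α * 2 ^ Fintype.card α ≤
      4 * ∑ c : α → Bool,
        (Finset.univ.filter fun z => B (fun i => (x i, c (x i))) z ≠ c z).card := by
    intro x
    have e1 : ∑ c : α → Bool,
        (Finset.univ.filter fun z => B (fun i => (x i, c (x i))) z ≠ c z).card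
        = ∑ z : α, (Finset.univ.filter fun c : α → Bool =>
            B (fun i => (x i, c (x i))) z ≠ c z).card := by
      simp only [Finset.card_filter]
      exact Finset.sum_comm
    -- Each point outside the sample is misclassified by exactly half of the labelings.
    have e2 : ∑ z ∈ Finset.univ \ Finset.univ.image x, 2 ^ Fintype.card α ≤
        2 * ∑ z : α, (Finset.univ.filter fun c : α → Bool =>
            B (fun i => (x i, c (x i))) z ≠ c z).card := by
      rw [Finset.mul_sum]
      refine (Finset.sum_le_sum fun z hz => ?_).trans
        (Finset.sum_le_sum_of_subset (Finset.subset_univ _))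
      refine (card_wrong_labelings (fun c => B (fun i => (x i, c (x i))) z) z ?_).ge
      intro c b
      have : ∀ i, x i ≠ z := by
        intro i hi
        simp only [Finset.mem_sdiff, Finset.mem_univ, Finset.mem_image, true_and, not_exists] at hz
        exact hz i hi
      simp [Function.update_of_ne (this _)]
    have e3 : Fintype.card α ≤ 2 * (Finset.univ \ Finset.univ.image x).card := by
      have := Finset.card_sdiff_add_card_eq_card (Finset.subset_univ (Finset.univ.image x))
      have h4 : (Finset.univ.image x).card ≤ m := by simpa using Finset.card_image_le (s := Finset.univ) (f := x)
      rw [Finset.card_univ] at this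
      omega
    rw [Finset.sum_const, smul_eq_mul] at e2
    rw [e1]
    calc _ ≤ 2 * (Finset.univ \ Finset.univ.image x).card * 2 ^ Fintype.card α :=
          Nat.mul_le_mul_right _ e3
      _ ≤ _ := by linarith
  have h1 : ∑ x : Fin m → α, Fintype.card α * 2 ^ Fintype.card α ≤
      ∑ c : α → Bool, 4 * ∑ x : Fin m → α,
        (Finset.univ.filter fun z => B (fun i => (x i, c (x i))) z ≠ c z).card := by
    refine (Finset.sum_le_sum fun x _ => hx x).trans (le_of_eq ?_)
    rw [← Finset.mul_sum, ← Finset.mul_sum, Finset.sum_comm]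
  have h2 : ∑ c : α → Bool, 4 * ∑ x : Fin m → α,
        (Finset.univ.filter fun z => B (fun i => (x i, c (x i))) z ≠ c z).card
        < ∑ c : α → Bool, Fintype.card α * Fintype.card α ^ m :=
    Finset.sum_lt_sum_of_nonempty Finset.univ_nonempty fun c _ => hcon c
  simp only [Finset.sum_const, Finset.card_univ, Fintype.card_fun, Fintype.card_fin,
    Fintype.card_bool, smul_eq_mul] at h1 h2
  have := h1.trans_lt h2
  have e : Fintype.card α ^ m * (Fintype.card α * 2 ^ Fintype.card α)
    = 2 ^ Fintype.card α * (Fintype.card α * Fintype.card α ^ m) := by ring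
  omega

theorem pi_uniform_apply {d m : ℕ} (hd : 0 < d) (s : Finset (Fin m → Fin d)) :
    (Measure.pi fun _ : Fin m => ((d : ℝ≥0∞)⁻¹ • (Measure.count : Measure (Fin d)))) s
      = s.card * ((d : ℝ≥0∞) ^ m)⁻¹ := by
  have hd' : (d : ℝ≥0∞) ≠ 0 := by exact_mod_cast hd.ne'
  have : IsFiniteMeasure ((d : ℝ≥0∞)⁻¹ • (Measure.count : Measure (Fin d))) :=
    Measure.smul_finite _ (by simpa using hd')
  rw [← sum_measure_singleton (s := s)]
  simp only [Measure.pi_singleton, Measure.smul_apply, Measure.count_singleton, smul_eq_mul,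
    mul_one, Finset.prod_const, Finset.card_univ, Fintype.card_fin, Finset.sum_const, nsmul_eq_mul]
  rw [ENNReal.inv_pow]

/-- **No free lunch**: a PAC-learnable class has finite VC dimension. -/
theorem IsPACLearnable.exists_not_shattersPoints {X : Type*} [MeasurableSpace X]
    {H : Set (X → Bool)} (hPAC : IsPACLearnable H) :
    ∃ d : ℕ, ∀ x : Fin d → X, ¬ ShattersPoints H x := by
  classical
  obtain ⟨A, N, hA⟩ := hPAC
  -- The maximum with `1` keeps the domain `Fin d` nonempty, so that the uniform distribution on it
  -- exists.
  set m := max (N (1 / 8) (1 / 16)) 1 with hm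
  have hm1 : 1 ≤ m := le_max_right _ _
  set d := 2 * m with hd
  have hd0 : 0 < d := by omega
  have hd' : (d : ℝ≥0∞) ≠ 0 := by exact_mod_cast hd0.ne'
  refine ⟨d, fun x₀ hx₀ => ?_⟩
  set U : Measure (Fin d) := (d : ℝ≥0∞)⁻¹ • Measure.count with hU
  have : IsProbabilityMeasure U := ⟨by
    simp [hU, Measure.count_univ, ENNReal.inv_mul_cancel hd' (ENNReal.natCast_ne_top d)]⟩
  have hxm : Measurable x₀ := measurable_of_finite _
  set P : Measure X := U.map x₀ with hP
  have : IsProbabilityMeasure P := Measure.isProbabilityMeasure_map hxm.aemeasurable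
  obtain ⟨b, hb⟩ := exists_labeling_with_large_error (α := Fin d) (m := m) (by simp [hd])
    (fun w z => A m (fun i => (x₀ (w i).1, (w i).2)) (x₀ z))
  obtain ⟨c, hcH, hcb⟩ := hx₀ b
  have key := hA (1 / 8) (1 / 16) (by norm_num) (by norm_num) (by norm_num) (by norm_num) P c hcH m
    (le_max_left _ _)
  set err : (Fin m → Fin d) → ℕ := fun x => (Finset.univ.filter fun z =>
    A m (fun i => (x₀ (x i), b (x i))) (x₀ z) ≠ b z).card with herr
  set bad : Finset (Fin m → Fin d) := Finset.univ.filter fun x => d < 8 * err x with hbad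
  have hpi : Measure.pi (fun _ : Fin m => P)
      = (Measure.pi fun _ : Fin m => U).map fun x i => x₀ (x i) :=
    (Measure.pi_map_pi fun _ => hxm.aemeasurable).symm
  -- The classifiers returned by the learner need not be measurable; `Measure.le_map_apply` compares
  -- with the outer measure of the image law, which suffices.
  have h1 : (bad.card : ℝ≥0∞) * ((d : ℝ≥0∞) ^ m)⁻¹ ≤ ENNReal.ofReal (1 / 16) := by
    rw [← pi_uniform_apply hd0]
    refine le_trans (le_trans (measure_mono ?_) (Measure.le_map_apply
      (f := fun (x : Fin m → Fin d) i => x₀ (x i)) (measurable_of_finite _).aemeasurable _)) (hpi ▸ key)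
    intro x hx
    simp only [hbad, Finset.coe_filter, Finset.mem_univ, true_and, Set.mem_ofPred_eq] at hx
    simp only [Set.preimage_ofPred_eq, Set.mem_ofPred_eq, hcb]
    refine lt_of_lt_of_le ?_ (Measure.le_map_apply hxm.aemeasurable _)
    have : (x₀ ⁻¹' {z | A m (fun i => (x₀ (x i), b (x i))) z ≠ c z})
        = ((Finset.univ.filter fun z => A m (fun i => (x₀ (x i), b (x i))) (x₀ z) ≠ b z :
            Finset (Fin d)) : Set (Fin d)) := by
      ext z; simp [hcb]
    rw [this, hU, Measure.smul_apply, Measure.count_apply_finset, smul_eq_mul]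
    rw [← ENNReal.div_eq_inv_mul, ENNReal.lt_div_iff_mul_lt (Or.inl hd') (Or.inl (by simp)),
      ← ENNReal.ofReal_natCast, ← ENNReal.ofReal_mul (by norm_num), ← ENNReal.ofReal_natCast,
      ENNReal.ofReal_lt_ofReal_iff']
    have hx' : (d : ℝ) < 8 * (err x : ℝ) := by exact_mod_cast hx
    have hd0' : (0 : ℝ) < d := by exact_mod_cast hd0
    constructor
    · show 1 / 8 * (d : ℝ) < (err x : ℝ); linarith
    · show 0 < (err x : ℝ); linarith
  have h2 : (16 : ℝ) * bad.card ≤ (d : ℝ) ^ m := by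
    rw [← ENNReal.div_eq_inv_mul.trans (mul_comm _ _),
      ENNReal.div_le_iff (by positivity) (by simp), ← Nat.cast_pow, ← ENNReal.ofReal_natCast,
      ← ENNReal.ofReal_natCast, ← ENNReal.ofReal_mul (by norm_num),
      ENNReal.ofReal_le_ofReal_iff (by positivity)] at h1
    push_cast at h1
    linarith
  -- The mean error rate is at most `1/8` from good samples plus `1/16` from bad ones, which is less
  -- than the `1/4` guaranteed by `hb`.
  have h3 : ∑ x, 8 * err x ≤ ∑ x, (d + if x ∈ bad then 8 * d else 0) := by
    refine Finset.sum_le_sum fun x _ => ?_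
    have : err x ≤ d := by simpa using Finset.card_le_univ (Finset.univ.filter fun z =>
      A m (fun i => (x₀ (x i), b (x i))) (x₀ z) ≠ b z)
    split_ifs with h
    · omega
    · simp only [hbad, Finset.mem_filter, Finset.mem_univ, true_and, not_lt] at h
      omega
  rw [Finset.sum_add_distrib, Finset.sum_ite_mem, Finset.univ_inter, ← Finset.mul_sum] at h3
  simp only [Finset.sum_const, Finset.card_univ, Fintype.card_fun, Fintype.card_fin,
    smul_eq_mul] at h3 hb
  have hb' : (d : ℝ) * d ^ m ≤ 4 * (∑ x, err x : ℕ) := by exact_mod_cast hb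
  have h3' : 8 * ((∑ x, err x : ℕ) : ℝ) ≤ d ^ m * d + bad.card * (8 * d) := by exact_mod_cast h3
  have hpos : (0 : ℝ) < d * d ^ m := by positivity
  have := mul_le_mul_of_nonneg_right h2 (Nat.cast_nonneg (α := ℝ) d)
  nlinarith

/-- The **Sauer-Shelah lemma** for the label vectors that a class realizes on a finite sample. -/
theorem card_traces_le {X ι : Type*} [Fintype ι] [DecidableEq ι] {H : Set (X → Bool)} {d : ℕ}
    (hd : ∀ x : Fin d → X, ¬ ShattersPoints H x) (x : ι → X) :
    ∃ 𝒜 : Finset (ι → Bool), (∀ h ∈ H, (fun i => h (x i)) ∈ 𝒜) ∧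
      (∀ b ∈ 𝒜, ∃ h ∈ H, (fun i => h (x i)) = b) ∧
      𝒜.card ≤ (d + 1) * (Fintype.card ι + 1) ^ d := by
  classical
  set 𝒜 : Finset (ι → Bool) := Finset.univ.filter fun b => ∃ h ∈ H, (fun i => h (x i)) = b with h𝒜
  refine ⟨𝒜, fun h hh => by simpa [h𝒜] using ⟨h, hh, rfl⟩, fun b hb => by simpa [h𝒜] using hb, ?_⟩
  set g : (ι → Bool) → Finset ι := fun b => Finset.univ.filter fun i => b i = true with hg
  have hginj : Function.Injective g := by
    intro b b' hbb
    funext i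
    have : i ∈ g b ↔ i ∈ g b' := by rw [hbb]
    simp only [hg, Finset.mem_filter, Finset.mem_univ, true_and] at this
    exact Bool.eq_iff_iff.2 this
  have hvc : (𝒜.image g).vcDim ≤ d := by
    refine Finset.sup_le fun s hs => ?_
    rw [Finset.mem_shatterer] at hs
    by_contra! hlt
    obtain ⟨s', hs's, hs'c⟩ := Finset.exists_subset_card_eq hlt.le
    have hsh := Finset.Shatters.mono_right hs's hs
    let e : Fin d ≃ s' := (Finset.equivFinOfCardEq hs'c).symm
    refine hd (fun i => x (e i)) fun b => ?_
    obtain ⟨u, hu, hsu⟩ := hsh (t := s'.filter fun i => ∃ j, (e j : ι) = i ∧ b j = true)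
      (Finset.filter_subset _ _)
    obtain ⟨b', hb', rfl⟩ := Finset.mem_image.1 hu
    obtain ⟨h, hh, rfl⟩ := (Finset.mem_filter.1 hb').2
    refine ⟨h, hh, fun j => ?_⟩
    have : ((e j : ι) ∈ s' ∩ g fun i => h (x i)) ↔
      (e j : ι) ∈ s'.filter fun i => ∃ j, (e j : ι) = i ∧ b j = true := by rw [hsu]
    simp only [hg, Finset.mem_inter, Finset.coe_mem, Finset.mem_filter, Finset.mem_univ, true_and]
      at this
    rw [Bool.eq_iff_iff, this]
    constructor
    · rintro ⟨k, hk, hbk⟩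
      rwa [e.injective (Subtype.ext hk)] at hbk
    · intro hj; exact ⟨j, rfl, hj⟩
  have hcard : 𝒜.card = (𝒜.image g).card := (Finset.card_image_of_injective _ hginj).symm
  rw [hcard]
  calc (𝒜.image g).card ≤ (𝒜.image g).shatterer.card := Finset.card_le_card_shatterer _
    _ ≤ ∑ k ∈ Finset.Iic (𝒜.image g).vcDim, (Fintype.card ι).choose k :=
      Finset.card_shatterer_le_sum_vcDim
    _ ≤ ∑ k ∈ Finset.Iic d, (Fintype.card ι).choose k :=
      Finset.sum_le_sum_of_subset (Finset.Iic_subset_Iic.2 hvc)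
    _ ≤ ∑ k ∈ Finset.Iic d, (Fintype.card ι + 1) ^ d := by
      refine Finset.sum_le_sum fun k hk => ?_
      refine (Nat.choose_le_pow _ _).trans ?_
      exact (Nat.pow_le_pow_left (Nat.le_succ _) k).trans
        (Nat.pow_le_pow_right (Nat.succ_pos _) (Finset.mem_Iic.1 hk))
    _ = _ := by simp

/-! ### Concentration of sums of independent variables. -/

/-- **Chebyshev's inequality** for sums of independent variables with values in `[-1, 1]`. -/
theorem measure_pi_abs_sum_sub_ge_le {ι : Type*} [Fintype ι] {Ω : ι → Type*}
    [∀ i, MeasurableSpace (Ω i)] (P : ∀ i, Measure (Ω i)) [∀ i, IsProbabilityMeasure (P i)]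
    (g : ∀ i, Ω i → ℝ) (hg : ∀ i, Measurable (g i)) (hb : ∀ i x, |g i x| ≤ 1) {c : ℝ} (hc : 0 < c) :
    Measure.pi P {x | c ≤ |∑ i, g i (x i) - ∑ i, ∫ y, g i y ∂P i|}
      ≤ ENNReal.ofReal (Fintype.card ι / c ^ 2) := by
  have hL : ∀ i, MemLp (g i) 2 (P i) := fun i =>
    MemLp.of_bound (hg i).aestronglyMeasurable 1 (ae_of_all _ (hb i))
  have hL' : ∀ i, MemLp (fun x : ∀ i, Ω i => g i (x i)) 2 (Measure.pi P) := fun i =>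
    MemLp.of_bound ((hg i).comp (measurable_pi_apply i)).aestronglyMeasurable 1
      (ae_of_all _ fun x => hb i (x i))
  have hS : MemLp (∑ i, fun x : ∀ i, Ω i => g i (x i)) 2 (Measure.pi P) :=
    memLp_finsetSum' _ fun i _ => hL' i
  have h := meas_ge_le_variance_div_sq hS hc
  have hE : ∫ x, (∑ i, fun x : ∀ i, Ω i => g i (x i)) x ∂Measure.pi P
      = ∑ i, ∫ y, g i y ∂P i := by
    simp only [Finset.sum_apply]
    rw [integral_finsetSum _ fun i _ => (hL' i).integrable (by norm_num)]
    exact Finset.sum_congr rfl fun i _ => integral_comp_eval (hL i).1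
  rw [hE, variance_sum_pi hL] at h
  simp only [Finset.sum_apply] at h
  refine h.trans (ENNReal.ofReal_le_ofReal (div_le_div_of_nonneg_right ?_ (sq_nonneg _)))
  calc ∑ i, Var[g i; P i] ≤ ∑ i : ι, (1 : ℝ) := by
        refine Finset.sum_le_sum fun i _ => ?_
        have := variance_le_sq_of_bounded (μ := P i) (a := -1) (b := 1) (X := g i)
          (ae_of_all _ fun x => abs_le.1 (hb i x)) (hg i).aemeasurable
        norm_num at this
        exact this
    _ = _ := by simp

/-- Chernoff's bound for Rademacher sums, as a count of sign vectors. -/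
theorem card_signs_le {n : ℕ} (c : Fin n → ℝ) (hc : ∀ i, |c i| ≤ 1) {u : ℝ} (hu : 0 ≤ u) :
    ((Finset.univ.filter fun σ : Fin n → Bool =>
      u < ∑ i, (if σ i then (-1 : ℝ) else 1) * c i).card : ℝ)
      ≤ 2 ^ n * Real.exp (-(u ^ 2 / (2 * n))) := by
  classical
  rcases Nat.eq_zero_or_pos n with rfl | hn
  · have h := Finset.card_le_univ (Finset.univ.filter fun σ : Fin 0 → Bool =>
      u < ∑ i, (if σ i then (-1 : ℝ) else 1) * c i)
    simpa using h
  have hn' : (0 : ℝ) < n := by exact_mod_cast hn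
  -- This exponent minimizes `n * l ^ 2 / 2 - l * u`.
  set l : ℝ := u / n with hl
  have hl0 : 0 ≤ l := by positivity
  have h1 : ((Finset.univ.filter fun σ : Fin n → Bool =>
      u < ∑ i, (if σ i then (-1 : ℝ) else 1) * c i).card : ℝ) * Real.exp (l * u)
      ≤ ∑ σ : Fin n → Bool, ∏ i, Real.exp (l * ((if σ i then (-1 : ℝ) else 1) * c i)) := by
    rw [← nsmul_eq_mul]
    refine (Finset.card_nsmul_le_sum _ _ _ fun σ hσ => ?_).trans
      (Finset.sum_le_sum_of_subset_of_nonneg (Finset.subset_univ _)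
        fun _ _ _ => Finset.prod_nonneg fun _ _ => (Real.exp_pos _).le)
    rw [← Real.exp_sum, ← Finset.mul_sum]
    exact Real.exp_le_exp.2 (mul_le_mul_of_nonneg_left (Finset.mem_filter.1 hσ).2.le hl0)
  have h2 : ∑ σ : Fin n → Bool, ∏ i, Real.exp (l * ((if σ i then (-1 : ℝ) else 1) * c i))
      = ∏ i, ∑ b : Bool, Real.exp (l * ((if b then (-1 : ℝ) else 1) * c i)) := by
    rw [Finset.prod_univ_sum, Fintype.piFinset_univ]
  have h3 : ∏ i, ∑ b : Bool, Real.exp (l * ((if b then (-1 : ℝ) else 1) * c i))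
      ≤ ∏ _i : Fin n, 2 * Real.exp (l ^ 2 / 2) := by
    refine Finset.prod_le_prod (fun i _ => Finset.sum_nonneg fun _ _ => (Real.exp_pos _).le)
      fun i _ => ?_
    have h4 := Real.cosh_le_exp_half_sq (l * c i)
    rw [Real.cosh_eq] at h4
    have h5 : Real.exp ((l * c i) ^ 2 / 2) ≤ Real.exp (l ^ 2 / 2) := by
      refine Real.exp_le_exp.2 (div_le_div_of_nonneg_right ?_ two_pos.le)
      rw [mul_pow]
      exact mul_le_of_le_one_right (sq_nonneg _) ((sq_le_one_iff_abs_le_one _).2 (hc i))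
    simp only [Fintype.sum_bool, if_true, Bool.false_eq_true, if_false, neg_mul, one_mul, mul_neg]
    linarith
  rw [Finset.prod_const, Finset.card_univ, Fintype.card_fin, mul_pow, ← Real.exp_nat_mul] at h3
  have h6 := h1.trans (h2.le.trans h3)
  rw [← le_div_iff₀ (Real.exp_pos _), mul_div_assoc, ← Real.exp_sub] at h6
  refine h6.trans (le_of_eq ?_)
  congr 2
  rw [hl]
  field_simp
  ring

/-! ### The empirical risk as a difference of means. -/

noncomputable section

/-- The numerical value of a label. -/
def labelValue (b : Bool) : ℝ := if b then 1 else 0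

/-- The number of observations of `S` after the split at `t`. -/
def numAfter {X : Type*} {𝒯 : Set ℝ} {n : ℕ} (S : Fin n → 𝒯 × X) (t : 𝒯) : ℝ :=
  ∑ i, if t < (S i).1 then 1 else 0

/-- The number of observations of `S` up to the split at `t`. -/
def numUpTo {X : Type*} {𝒯 : Set ℝ} {n : ℕ} (S : Fin n → 𝒯 × X) (t : 𝒯) : ℝ :=
  ∑ i, if t < (S i).1 then 0 else 1

/-- The number of observations of `S` after the split at `t` which `h` classifies as positive. -/
def sumAfter {X : Type*} {𝒯 : Set ℝ} {n : ℕ} (S : Fin n → 𝒯 × X) (t : 𝒯) (h : X → Bool) : ℝ :=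
  ∑ i, if t < (S i).1 then labelValue (h (S i).2) else 0

/-- The number of observations of `S` up to the split at `t` which `h` classifies as positive. -/
def sumUpTo {X : Type*} {𝒯 : Set ℝ} {n : ℕ} (S : Fin n → 𝒯 × X) (t : 𝒯) (h : X → Bool) : ℝ :=
  ∑ i, if t < (S i).1 then 0 else labelValue (h (S i).2)

end

section

variable {X : Type*} {𝒯 : Set ℝ} {n : ℕ}

theorem labelValue_nonneg (b : Bool) : 0 ≤ labelValue b := by cases b <;> simp [labelValue]

theorem labelValue_le_one (b : Bool) : labelValue b ≤ 1 := by cases b <;> simp [labelValue]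

theorem measurable_labelValue : Measurable labelValue := measurable_of_finite _

theorem labelFreq_true (S : Fin n → 𝒯 × X) (t : 𝒯) : labelFreq S t true = numAfter S t / n := by
  simp [labelFreq, numAfter, afterLabel]

theorem labelFreq_false (S : Fin n → 𝒯 × X) (t : 𝒯) : labelFreq S t false = numUpTo S t / n := by
  rw [labelFreq, numUpTo, Finset.card_filter]
  push_cast
  congr 1
  refine Finset.sum_congr rfl fun i _ => ?_
  by_cases h : t < (S i).1 <;> simp [afterLabel, h]

theorem numAfter_add_numUpTo (S : Fin n → 𝒯 × X) (t : 𝒯) : numAfter S t + numUpTo S t = n := by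
  rw [numAfter, numUpTo, ← Finset.sum_add_distrib]
  have : ∀ i, ((if t < (S i).1 then (1 : ℝ) else 0) + if t < (S i).1 then 0 else 1) = 1 := by
    intro i; split_ifs <;> simp
  simp [this]

theorem empiricalRisk_nonneg (S : Fin n → 𝒯 × X) (t : 𝒯) (h : X → Bool) :
    0 ≤ empiricalRisk S t h := by
  refine mul_nonneg (by positivity) (Finset.sum_nonneg fun i _ => ?_)
  unfold weightedLoss labelFreq
  split_ifs <;> positivity

/-- The reweighted risk is half the sum of the miss rate after the split and the false positive rate
up to it. Both sides must be nonempty: with an empty side, division by zero would break the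
identity. -/
theorem half_sub_empiricalRisk (S : Fin n → 𝒯 × X) (t : 𝒯) (h : X → Bool)
    (ha : 0 < numAfter S t) (hu : 0 < numUpTo S t) :
    1 / 2 - empiricalRisk S t h =
      1 / 2 * (sumAfter S t h / numAfter S t - sumUpTo S t h / numUpTo S t) := by
  have hn : (0 : ℝ) < n := by rw [← numAfter_add_numUpTo S t]; positivity
  have e : ∀ i, weightedLoss (labelFreq S t) (h (S i).2) (afterLabel t (S i).1)
      = ((if t < (S i).1 then 1 else 0) - (if t < (S i).1 then labelValue (h (S i).2) else 0))
          * (n / (2 * numAfter S t))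
        + (if t < (S i).1 then 0 else labelValue (h (S i).2)) * (n / (2 * numUpTo S t)) := by
    intro i
    by_cases hi : t < (S i).1
    · cases h (S i).2 <;> simp [weightedLoss, afterLabel, hi, labelValue, labelFreq_true]
      field_simp
    · cases h (S i).2 <;> simp [weightedLoss, afterLabel, hi, labelValue, labelFreq_false]
      field_simp
  have e2 : empiricalRisk S t h = 1 / n * ((numAfter S t - sumAfter S t h)
      * (n / (2 * numAfter S t)) + sumUpTo S t h * (n / (2 * numUpTo S t))) := by
    rw [empiricalRisk, Finset.sum_congr rfl fun i _ => e i, Finset.sum_add_distrib,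
      ← Finset.sum_mul, ← Finset.sum_mul, Finset.sum_sub_distrib]
    rfl
  rw [e2]
  field_simp
  ring

theorem lt_plugIn_iff {H : Set (X → Bool)} (hne : H.Nonempty) (S : Fin n → 𝒯 × X) (t : 𝒯)
    (c : ℝ) : c < plugIn H 𝒯 n S t ↔ ∃ h ∈ H, c < 1 / 2 - empiricalRisk S t h := by
  have := hne.to_subtype
  have hb : BddBelow (Set.range fun h : H => empiricalRisk S t h) :=
    ⟨0, by rintro _ ⟨h, rfl⟩; exact empiricalRisk_nonneg S t h⟩
  rw [plugIn, lt_sub_comm, ciInf_lt_iff hb, Subtype.exists]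
  simp only [lt_sub_comm, exists_prop]

theorem plugIn_le_iff {H : Set (X → Bool)} (hne : H.Nonempty) (S : Fin n → 𝒯 × X) (t : 𝒯)
    (c : ℝ) : plugIn H 𝒯 n S t ≤ c ↔ ∀ h ∈ H, 1 / 2 - empiricalRisk S t h ≤ c := by
  rw [← not_lt, lt_plugIn_iff hne]
  push Not
  rfl

end

/-! ### Symmetrization and the uniform deviation inequality. -/

section

variable {X : Type*} [MeasurableSpace X] {𝒯 : Set ℝ} {n : ℕ}

/-- The set where a symmetrized deviation is large is described by the plug-in statistic of a
window of twice the size. -/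
theorem measurableSet_symmetrized {H : Set (X → Bool)} (hne : H.Nonempty)
    (hmeas : IsEstimator (plugIn H 𝒯)) {s t : 𝒯} (hst : s < t) (a : Fin n → ℝ)
    (ha : ∀ i, a i = 1 ∨ a i = 0 ∨ a i = -1) (u : ℝ) :
    MeasurableSet {w : Fin n → X × X | ∃ h ∈ H,
      u < ∑ i, a i * (labelValue (h (w i).1) - labelValue (h (w i).2))} := by
  classical
  rcases Nat.eq_zero_or_pos n with rfl | hn
  · simp only [Finset.univ_eq_empty, Finset.sum_empty]
    exact MeasurableSet.const _
  have hn' : (0 : ℝ) < n := by exact_mod_cast hn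
  -- `H` may be uncountable, so measurability has to come from `plugIn`. This artificial window has
  -- `n` points at time `t` and `n` at time `s`, and its split at `s` compares the two halves. The
  -- pair `w i` enters in order for `a i = 1`, in reverse order for `a i = -1`, and as two
  -- cancelling copies of its first point for `a i = 0`.
  let W : (Fin n → X × X) → Fin (n + n) → 𝒯 × X := fun w =>
    Fin.append (fun i => (t, if a i = -1 then (w i).2 else (w i).1))
      (fun i => (s, if a i = 1 then (w i).2 else (w i).1))
  have hW : Measurable W := by
    refine measurable_pi_lambda _ fun i => ?_
    refine Fin.addCases (fun j => ?_) (fun j => ?_) i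
    · simp only [W, Fin.append_left]
      split_ifs <;> fun_prop
    · simp only [W, Fin.append_right]
      split_ifs <;> fun_prop
  have hA : ∀ w, numAfter (W w) s = n := fun w => by
    rw [numAfter, Fin.sum_univ_add]
    simp only [W, Fin.append_left, Fin.append_right]
    simp [hst]
  have hU : ∀ w, numUpTo (W w) s = n := fun w => by
    rw [numUpTo, Fin.sum_univ_add]
    simp only [W, Fin.append_left, Fin.append_right]
    simp [hst]
  have hd : ∀ w (h : X → Bool), 1 / 2 - empiricalRisk (W w) s h
      = (∑ i, a i * (labelValue (h (w i).1) - labelValue (h (w i).2))) / (2 * n) := by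
    intro w h
    rw [half_sub_empiricalRisk _ _ _ (by rw [hA]; exact hn') (by rw [hU]; exact hn'), hA, hU,
      ← sub_div, sumAfter, sumUpTo, Fin.sum_univ_add, Fin.sum_univ_add]
    simp only [W, Fin.append_left, Fin.append_right, hst, lt_irrefl, if_true, if_false,
      Finset.sum_const_zero, add_zero, zero_add]
    rw [← Finset.sum_sub_distrib, div_mul_div_comm, one_mul]
    congr 1
    refine Finset.sum_congr rfl fun i _ => ?_
    rcases ha i with h1 | h1 | h1 <;> norm_num [h1]
  have hset : {w : Fin n → X × X | ∃ h ∈ H,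
      u < ∑ i, a i * (labelValue (h (w i).1) - labelValue (h (w i).2))}
      = (fun w => plugIn H 𝒯 (n + n) (W w) s) ⁻¹' Set.Ioi (u / (2 * n)) := by
    ext w
    simp only [Set.mem_ofPred_eq, Set.mem_preimage, Set.mem_Ioi, lt_plugIn_iff hne, hd]
    simp only [div_lt_div_iff_of_pos_right (show (0 : ℝ) < 2 * n by positivity)]
  rw [hset]
  exact ((hmeas (n + n)).comp (hW.prodMk measurable_const)) measurableSet_Ioi

/-- The symmetrized deviation is uniformly small. -/
theorem measure_symmetrized_le {H : Set (X → Bool)} (hne : H.Nonempty)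
    (hmeas : IsEstimator (plugIn H 𝒯)) {s t : 𝒯} (hst : s < t) {d : ℕ}
    (hd : ∀ x : Fin d → X, ¬ ShattersPoints H x)
    (P : Fin n → Measure X) [∀ i, IsProbabilityMeasure (P i)] (a : Fin n → ℝ)
    (ha : ∀ i, a i = 1 ∨ a i = 0 ∨ a i = -1) {u : ℝ} (hu : 0 ≤ u) :
    (Measure.pi fun i => (P i).prod (P i)) {w : Fin n → X × X | ∃ h ∈ H,
        u < ∑ i, a i * (labelValue (h (w i).1) - labelValue (h (w i).2))}
      ≤ ENNReal.ofReal ((d + 1) * (2 * n + 1) ^ d * Real.exp (-(u ^ 2 / (2 * n)))) := by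
  classical
  set ρ : Measure (Fin n → X × X) := Measure.pi fun i => (P i).prod (P i) with hρ
  set G : Set (Fin n → X × X) := {w : Fin n → X × X | ∃ h ∈ H,
        u < ∑ i, a i * (labelValue (h (w i).1) - labelValue (h (w i).2))} with hG
  have hGm : MeasurableSet G := measurableSet_symmetrized hne hmeas hst a ha u
  set K : ℝ := (d + 1) * (2 * n + 1) ^ d * Real.exp (-(u ^ 2 / (2 * n))) with hK
  -- Swapping the two entries of selected pairs preserves the law, so the measure of `G` equals its
  -- average over all swaps. For fixed `w` this average counts sign vectors, to be bounded by a
  -- union over traces.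
  let Φ : (Fin n → Bool) → (Fin n → X × X) → Fin n → X × X := fun σ w i =>
    (if σ i then Prod.swap else id) (w i)
  have hΦ : ∀ σ, MeasurePreserving (Φ σ) ρ ρ := by
    intro σ
    refine measurePreserving_pi (fun i => (P i).prod (P i)) (fun i => (P i).prod (P i))
      (f := fun i => if σ i then Prod.swap else id) fun i => ?_
    split_ifs
    · exact Measure.measurePreserving_swap
    · exact MeasurePreserving.id _
  have hcount : ∀ w, ((Finset.univ.filter fun σ => Φ σ w ∈ G).card : ℝ) ≤ 2 ^ n * K := by
    intro w
    obtain ⟨𝒜, h𝒜, -, hcard⟩ := card_traces_le hd (fun j : Fin n ⊕ Fin n =>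
      Sum.elim (fun i => (w i).1) (fun i => (w i).2) j)
    let c : (Fin n ⊕ Fin n → Bool) → Fin n → ℝ := fun b i =>
      a i * (labelValue (b (Sum.inl i)) - labelValue (b (Sum.inr i)))
    have hc : ∀ b i, |c b i| ≤ 1 := by
      intro b i
      rcases ha i with h1 | h1 | h1 <;>
        cases h2 : b (Sum.inl i) <;> cases h3 : b (Sum.inr i) <;>
        norm_num [c, h1, h2, h3, labelValue]
    have hsub : (Finset.univ.filter fun σ => Φ σ w ∈ G) ⊆ 𝒜.biUnion fun b =>
        Finset.univ.filter fun σ : Fin n → Bool =>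
          u < ∑ i, (if σ i then (-1 : ℝ) else 1) * c b i := by
      intro σ hσ
      obtain ⟨h, hh, hlt⟩ := (Finset.mem_filter.1 hσ).2
      refine Finset.mem_biUnion.2 ⟨_, h𝒜 h hh, Finset.mem_filter.2 ⟨Finset.mem_univ _, ?_⟩⟩
      refine hlt.trans_le (le_of_eq (Finset.sum_congr rfl fun i _ => ?_))
      by_cases hi : σ i = true
      · simp only [Φ, c, hi, if_true, Prod.fst_swap, Prod.snd_swap, Sum.elim_inl, Sum.elim_inr]
        ring
      · simp [Φ, c, hi]
    calc ((Finset.univ.filter fun σ => Φ σ w ∈ G).card : ℝ)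
        ≤ ((∑ b ∈ 𝒜, (Finset.univ.filter fun σ : Fin n → Bool =>
          u < ∑ i, (if σ i then (-1 : ℝ) else 1) * c b i).card : ℕ) : ℝ) := by
          exact_mod_cast (Finset.card_le_card hsub).trans Finset.card_biUnion_le
      _ ≤ ∑ b ∈ 𝒜, 2 ^ n * Real.exp (-(u ^ 2 / (2 * n))) := by
          push_cast
          exact Finset.sum_le_sum fun b _ => card_signs_le (c b) (hc b) hu
      _ = 𝒜.card * (2 ^ n * Real.exp (-(u ^ 2 / (2 * n)))) := by
          rw [Finset.sum_const, nsmul_eq_mul]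
      _ ≤ ((d + 1) * (2 * n + 1) ^ d) * (2 ^ n * Real.exp (-(u ^ 2 / (2 * n)))) := by
          refine mul_le_mul_of_nonneg_right ?_ (by positivity)
          rw [Fintype.card_sum, Fintype.card_fin, ← two_mul] at hcard
          exact_mod_cast hcard
      _ = _ := by rw [hK]; ring
  have hsum : (2 : ℝ≥0∞) ^ n * ρ G ≤ 2 ^ n * ENNReal.ofReal K := by
    calc (2 : ℝ≥0∞) ^ n * ρ G = ∑ σ : Fin n → Bool, ρ (Φ σ ⁻¹' G) := by
          simp [(hΦ _).measure_preimage hGm.nullMeasurableSet]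
      _ = ∑ σ : Fin n → Bool, ∫⁻ w, (Φ σ ⁻¹' G).indicator 1 w ∂ρ :=
          Finset.sum_congr rfl fun σ _ => (lintegral_indicator_one ((hΦ σ).measurable hGm)).symm
      _ = ∫⁻ w, ∑ σ : Fin n → Bool, (Φ σ ⁻¹' G).indicator 1 w ∂ρ :=
          (lintegral_finsetSum _ fun σ _ =>
            measurable_one.indicator ((hΦ σ).measurable hGm)).symm
      _ ≤ ∫⁻ _, 2 ^ n * ENNReal.ofReal K ∂ρ := by
          refine lintegral_mono fun w => ?_
          have : ∑ σ : Fin n → Bool, (Φ σ ⁻¹' G).indicator (1 : (Fin n → X × X) → ℝ≥0∞) w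
              = ((Finset.univ.filter fun σ => Φ σ w ∈ G).card : ℝ≥0∞) := by
            simp [Set.indicator_apply]
          rw [this, ← ENNReal.ofReal_natCast]
          refine (ENNReal.ofReal_le_ofReal (hcount w)).trans (le_of_eq ?_)
          rw [ENNReal.ofReal_mul (by positivity), ENNReal.ofReal_pow (by norm_num)]
          simp
      _ = _ := by simp
  exact (ENNReal.mul_le_mul_iff_right (by simp) (by simp)).1 hsum

/-- **Uniform deviation bound** of Vapnik and Chervonenkis, for independent observations which need
not be identically distributed. -/
theorem measure_exists_deviation_le {H : Set (X → Bool)} (hne : H.Nonempty)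
    (hH : ∀ h ∈ H, Measurable h)
    (hmeas : IsEstimator (plugIn H 𝒯)) {s t : 𝒯} (hst : s < t) {d : ℕ}
    (hd : ∀ x : Fin d → X, ¬ ShattersPoints H x)
    (P : Fin n → Measure X) [∀ i, IsProbabilityMeasure (P i)] (a : Fin n → ℝ)
    (ha : ∀ i, a i = 1 ∨ a i = 0 ∨ a i = -1) {u : ℝ} (hu : 0 < u) (hun : 8 * n ≤ u ^ 2) :
    Measure.pi P {x | ∃ h ∈ H,
        u < ∑ i, a i * (labelValue (h (x i)) - ∫ y, labelValue (h y) ∂P i)}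
      ≤ ENNReal.ofReal (2 * ((d + 1) * (2 * n + 1) ^ d * Real.exp (-(u ^ 2 / (8 * n))))) := by
  set μ := Measure.pi P with hμ
  set G : Set (Fin n → X × X) := {w : Fin n → X × X | ∃ h ∈ H,
        u / 2 < ∑ i, a i * (labelValue (h (w i).1) - labelValue (h (w i).2))} with hG
  have hGm : MeasurableSet G := measurableSet_symmetrized hne hmeas hst a ha _
  set e := MeasurableEquiv.arrowProdEquivProdArrow X X (Fin n) with he
  have hmp := measurePreserving_arrowProdEquivProdArrow X X (Fin n) P P
  set G' : Set ((Fin n → X) × (Fin n → X)) := e.symm ⁻¹' G with hG'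
  have hG'm : MeasurableSet G' := e.symm.measurable hGm
  have hGG' : (μ.prod μ) G' = (Measure.pi fun i => (P i).prod (P i)) G :=
    (hmp.symm e).measure_preimage hGm.nullMeasurableSet
  -- The ghost sample: if `x` deviates by more than `u` for some `h`, an independent copy stays
  -- within `u / 2` of its mean for the same `h` with probability at least `1/2`. Markov's
  -- inequality then costs the factor `2`.
  have hsub : {x | ∃ h ∈ H, u < ∑ i, a i * (labelValue (h (x i)) - ∫ y, labelValue (h y) ∂P i)}
      ⊆ {x | 1 / 2 ≤ μ (Prod.mk x ⁻¹' G')} := by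
    rintro x ⟨h, hh, hx⟩
    have hbound : ∀ i y, |a i * labelValue (h y)| ≤ 1 := by
      intro i y
      rcases ha i with h1 | h1 | h1 <;> cases h2 : h y <;> norm_num [h1, h2, labelValue]
    have hcheb := measure_pi_abs_sum_sub_ge_le P (fun i y => a i * labelValue (h y))
      (fun i => (measurable_labelValue.comp (hH h hh)).const_mul _) hbound (half_pos hu)
    have hcompl : (Prod.mk x ⁻¹' G')ᶜ ⊆ {x' | u / 2 ≤ |∑ i, a i * labelValue (h (x' i))
        - ∑ i, ∫ y, a i * labelValue (h y) ∂P i|} := by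
      intro x' hx'
      by_contra hlt
      simp only [Set.mem_ofPred_eq, not_le, integral_const_mul] at hlt
      refine hx' ⟨h, hh, ?_⟩
      have h2 := (abs_lt.1 hlt).2
      simp only [mul_sub, Finset.sum_sub_distrib] at hx ⊢
      show u / 2 < ∑ i, a i * labelValue (h (x i)) - ∑ i, a i * labelValue (h (x' i))
      linarith
    -- Chebyshev's bound is `4 * n / u ^ 2`, and `hun` makes it at most `1/2`.
    have h3 : μ (Prod.mk x ⁻¹' G')ᶜ ≤ ENNReal.ofReal (1 / 2) := by
      refine (measure_mono hcompl).trans (hcheb.trans (ENNReal.ofReal_le_ofReal ?_))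
      rw [Fintype.card_fin, div_le_iff₀ (by positivity)]
      linarith
    have h4 := prob_add_prob_compl (μ := μ) (measurable_prodMk_left (x := x) hG'm)
    show 1 / 2 ≤ μ (Prod.mk x ⁻¹' G')
    by_contra hlt
    push Not at hlt
    have h5 : ENNReal.ofReal (1 / 2) = 1 / 2 := by
      rw [ENNReal.ofReal_div_of_pos two_pos]; simp
    rw [h5] at h3
    have := ENNReal.add_lt_add_of_lt_of_le (by exact (h3.trans_lt (by simp [ENNReal.inv_lt_top])).ne) hlt h3
    rw [h4, ENNReal.add_halves] at this
    exact lt_irrefl _ this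
  have hmarkov := mul_meas_ge_le_lintegral (μ := μ) (measurable_measure_prodMk_left (ν := μ) hG'm)
    (1 / 2)
  rw [← Measure.prod_apply hG'm, hGG'] at hmarkov
  have hb := hmarkov.trans (measure_symmetrized_le hne hmeas hst hd P a ha (half_pos hu).le)
  have e8 : (u / 2) ^ 2 / (2 * n) = u ^ 2 / (8 * n) := by
    rw [div_pow, div_div]; congr 1; ring
  rw [e8] at hb
  refine (measure_mono hsub).trans ?_
  rw [ENNReal.ofReal_mul two_pos.le]
  calc _ = 2 * (1 / 2 * μ {x | 1 / 2 ≤ μ (Prod.mk x ⁻¹' G')}) := by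
        rw [← mul_assoc, one_div, ENNReal.mul_inv_cancel (by simp) (by simp), one_mul]
    _ ≤ _ := by
        rw [ENNReal.ofReal_ofNat]
        gcongr

end

/-! ### Mismatch of splits and the effect of a single change point. -/

noncomputable section

/-- The relative frequency in `S` of the arrival times which the splits at `t₀` and `t` put on
different sides. -/
def mismatch {X : Type*} {𝒯 : Set ℝ} {n : ℕ} (S : Fin n → 𝒯 × X) (t₀ t : 𝒯) : ℝ :=
  (∑ i, if afterLabel t (S i).1 = afterLabel t₀ (S i).1 then 0 else 1) / n

/-- The split at `t` leaves at least the fraction `r` of the window on both sides. -/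
def IsTrimmed {X : Type*} {𝒯 : Set ℝ} {n : ℕ} (r : ℝ) (S : Fin n → 𝒯 × X) (t : 𝒯) : Prop :=
  r ≤ labelFreq S t false ∧ labelFreq S t false < 1 - r

end

section

variable {X : Type*} {𝒯 : Set ℝ} {n : ℕ}

theorem mismatch_nonneg (S : Fin n → 𝒯 × X) (t₀ t : 𝒯) : 0 ≤ mismatch S t₀ t :=
  div_nonneg (Finset.sum_nonneg fun i _ => by split_ifs <;> norm_num) (Nat.cast_nonneg n)

theorem IsTrimmed.size_pos {r : ℝ} (hr : 0 < r) {S : Fin n → 𝒯 × X} {t : 𝒯}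
    (h : IsTrimmed r S t) : (0 : ℝ) < n := by
  rcases Nat.eq_zero_or_pos n with rfl | hn
  · have := h.1
    rw [labelFreq_false, Nat.cast_zero, div_zero] at this
    linarith
  · exact_mod_cast hn

theorem IsTrimmed.le_numUpTo {r : ℝ} (hr : 0 < r) {S : Fin n → 𝒯 × X} {t : 𝒯}
    (h : IsTrimmed r S t) : n * r ≤ numUpTo S t := by
  have h1 := h.1
  rwa [labelFreq_false, le_div_iff₀ (h.size_pos hr), mul_comm] at h1

theorem IsTrimmed.le_numAfter {r : ℝ} (hr : 0 < r) {S : Fin n → 𝒯 × X} {t : 𝒯}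
    (h : IsTrimmed r S t) : n * r ≤ numAfter S t := by
  have h1 := h.2
  rw [labelFreq_false, div_lt_iff₀ (h.size_pos hr)] at h1
  have := numAfter_add_numUpTo S t
  linarith

theorem exists_lt_of_numAfter_pos {S : Fin n → 𝒯 × X} {t : 𝒯} (h : 0 < numAfter S t) :
    ∃ i, t < (S i).1 := by
  by_contra! hc
  refine h.ne' (Finset.sum_eq_zero fun i _ => if_neg (hc i).not_gt)

theorem exists_le_of_numUpTo_pos {S : Fin n → 𝒯 × X} {t : 𝒯} (h : 0 < numUpTo S t) :
    ∃ i, (S i).1 ≤ t := by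
  by_contra! hc
  refine h.ne' (Finset.sum_eq_zero fun i _ => if_pos (hc i))

/-- Every split with an observation up to it is equivalent to the split at some arrival time. -/
theorem exists_afterLabel_eq {S : Fin n → 𝒯 × X} {t : 𝒯} (h : 0 < numUpTo S t) :
    ∃ j, ∀ i, afterLabel t (S i).1 = afterLabel (S j).1 (S i).1 := by
  obtain ⟨i₀, hi₀⟩ := exists_le_of_numUpTo_pos h
  obtain ⟨j, hj, hmax⟩ := Finset.exists_max_image
    (Finset.univ.filter fun i => (S i).1 ≤ t) (fun i => (S i).1) ⟨i₀, by simpa using hi₀⟩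
  simp only [Finset.mem_filter, Finset.mem_univ, true_and] at hj hmax
  refine ⟨j, fun i => ?_⟩
  simp only [afterLabel, decide_eq_decide]
  refine ⟨hj.trans_lt, fun hi => ?_⟩
  by_contra! hc
  exact (hmax i hc).not_gt hi

theorem labelFreq_congr {S : Fin n → 𝒯 × X} {t t' : 𝒯}
    (h : ∀ i, afterLabel t (S i).1 = afterLabel t' (S i).1) : labelFreq S t = labelFreq S t' := by
  funext y
  simp only [labelFreq, h]

theorem plugIn_congr (H : Set (X → Bool)) {S : Fin n → 𝒯 × X} {t t' : 𝒯}
    (h : ∀ i, afterLabel t (S i).1 = afterLabel t' (S i).1) :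
    plugIn H 𝒯 n S t = plugIn H 𝒯 n S t' := by
  simp only [plugIn, empiricalRisk, labelFreq_congr h, h]

theorem mismatch_congr {S : Fin n → 𝒯 × X} (t₀ : 𝒯) {t t' : 𝒯}
    (h : ∀ i, afterLabel t (S i).1 = afterLabel t' (S i).1) :
    mismatch S t₀ t = mismatch S t₀ t' := by
  simp only [mismatch, h]

/-- A split other than `t₀` leaves one side pure and mixes the two phases on the other. The mixing
shrinks the difference of means by the foreign fraction of the mixed side, which is at least
`mismatch` because that side has at most `n` observations. Trimming turns a deviation `u` of a sum
into at most `u / (n * r)` for a mean. -/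
theorem half_sub_empiricalRisk_le {S : Fin n → 𝒯 × X} {t t₀ : 𝒯} {r u : ℝ} (hr : 0 < r)
    (hu : 0 ≤ u) (ht : IsTrimmed r S t) {h : X → Bool} {P Q Δ : ℝ} (hΔ : 0 ≤ Δ)
    (hPQ : 1 / 2 * (Q - P) ≤ Δ)
    (h1 : ∑ i, (if t < (S i).1 then (1 : ℝ) else 0)
      * (labelValue (h (S i).2) - if (S i).1 ≤ t₀ then P else Q) ≤ u)
    (h2 : ∑ i, (if t < (S i).1 then (0 : ℝ) else -1)
      * (labelValue (h (S i).2) - if (S i).1 ≤ t₀ then P else Q) ≤ u) :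
    1 / 2 - empiricalRisk S t h ≤ (1 - mismatch S t₀ t) * Δ + u / (n * r) := by
  have hn := ht.size_pos hr
  have hnr : 0 < n * r := by positivity
  have hA := ht.le_numAfter hr
  have hU := ht.le_numUpTo hr
  have hA0 : 0 < numAfter S t := hnr.trans_le hA
  have hU0 : 0 < numUpTo S t := hnr.trans_le hU
  rw [half_sub_empiricalRisk S t h hA0 hU0]
  -- `A` and `B` count the observations from phase `P` after and up to the split. The conditional
  -- expectation of the difference of means is `(B / numUpTo S t - A / numAfter S t) * (Q - P)`.
  set A : ℝ := ∑ i, if t < (S i).1 ∧ (S i).1 ≤ t₀ then 1 else 0 with hAdef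
  set B : ℝ := ∑ i, if (S i).1 ≤ t ∧ (S i).1 ≤ t₀ then 1 else 0 with hBdef
  have e1 : ∑ i, (if t < (S i).1 then (1 : ℝ) else 0)
      * (labelValue (h (S i).2) - if (S i).1 ≤ t₀ then P else Q)
      = sumAfter S t h - (numAfter S t * Q - A * (Q - P)) := by
    rw [sumAfter, numAfter, hAdef, Finset.sum_mul, Finset.sum_mul, ← Finset.sum_sub_distrib,
      ← Finset.sum_sub_distrib]
    refine Finset.sum_congr rfl fun i _ => ?_
    by_cases c1 : t < (S i).1 <;> by_cases c2 : (S i).1 ≤ t₀ <;> simp [c1, c2]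
  have e2 : ∑ i, (if t < (S i).1 then (0 : ℝ) else -1)
      * (labelValue (h (S i).2) - if (S i).1 ≤ t₀ then P else Q)
      = (numUpTo S t * Q - B * (Q - P)) - sumUpTo S t h := by
    rw [sumUpTo, numUpTo, hBdef, Finset.sum_mul, Finset.sum_mul, ← Finset.sum_sub_distrib,
      ← Finset.sum_sub_distrib]
    refine Finset.sum_congr rfl fun i _ => ?_
    by_cases c1 : t < (S i).1 <;> by_cases c2 : (S i).1 ≤ t₀ <;>
      simp [c1, c2, not_le.2, not_lt.1]
  rw [e1] at h1
  rw [e2] at h2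
  have hn0 : (n : ℝ) = numAfter S t + numUpTo S t := (numAfter_add_numUpTo S t).symm
  have hw : 0 ≤ B / numUpTo S t - A / numAfter S t ∧
      B / numUpTo S t - A / numAfter S t ≤ 1 - mismatch S t₀ t := by
    rcases le_or_gt t₀ t with hc | hc
    · have hA' : A = 0 := Finset.sum_eq_zero fun i _ =>
        if_neg fun hi => (hi.1.trans_le (hi.2.trans hc)).false
      have hB' : n * mismatch S t₀ t = numUpTo S t - B := by
        rw [mismatch, mul_div_cancel₀ _ hn.ne', numUpTo, hBdef, ← Finset.sum_sub_distrib]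
        refine Finset.sum_congr rfl fun i _ => ?_
        by_cases c1 : t < (S i).1
        · simp [afterLabel, c1, hc.trans_lt c1, c1.not_ge]
        · by_cases c2 : t₀ < (S i).1
          · simp [afterLabel, c1, c2, c2.not_ge]
          · simp [afterLabel, c1, c2, not_lt.1 c1, not_lt.1 c2]
      have hB0 : 0 ≤ B := Finset.sum_nonneg fun i _ => by split_ifs <;> norm_num
      have hm := mismatch_nonneg S t₀ t
      rw [hA', zero_div, sub_zero]
      refine ⟨by positivity, ?_⟩
      rw [div_le_iff₀ hU0]
      nlinarith
    · have hB' : B = numUpTo S t := by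
        rw [hBdef, numUpTo]
        refine Finset.sum_congr rfl fun i _ => ?_
        by_cases c1 : t < (S i).1
        · simp [c1, c1.not_ge]
        · simp [c1, not_lt.1 c1, (not_lt.1 c1).trans hc.le]
      have hA' : n * mismatch S t₀ t = A := by
        rw [mismatch, mul_div_cancel₀ _ hn.ne', hAdef]
        refine Finset.sum_congr rfl fun i _ => ?_
        by_cases c1 : t < (S i).1
        · by_cases c2 : t₀ < (S i).1
          · simp [afterLabel, c1, c2, c2.not_ge]
          · simp [afterLabel, c1, c2, not_lt.1 c2]
        · have c2 : ¬ t₀ < (S i).1 := fun c2 => c1 (hc.trans c2)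
          simp [afterLabel, c1, c2]
      have hAle : A ≤ numAfter S t := by
        rw [hAdef, numAfter]
        refine Finset.sum_le_sum fun i _ => ?_
        by_cases c1 : t < (S i).1
        · rw [if_pos c1]; split_ifs <;> norm_num
        · simp [c1]
      have hm := mismatch_nonneg S t₀ t
      rw [hB', div_self hU0.ne']
      refine ⟨sub_nonneg.2 ((div_le_one hA0).2 hAle), ?_⟩
      refine sub_le_sub_left ?_ _
      rw [le_div_iff₀ hA0]
      nlinarith
  have k1 : sumAfter S t h / numAfter S t ≤ Q - A / numAfter S t * (Q - P) + u / (n * r) := by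
    have : sumAfter S t h / numAfter S t ≤ Q - A / numAfter S t * (Q - P) + u / numAfter S t := by
      rw [div_le_iff₀ hA0]
      field_simp
      linarith
    exact this.trans (by gcongr)
  have k2 : Q - B / numUpTo S t * (Q - P) - u / (n * r) ≤ sumUpTo S t h / numUpTo S t := by
    have : Q - B / numUpTo S t * (Q - P) - u / numUpTo S t ≤ sumUpTo S t h / numUpTo S t := by
      rw [le_div_iff₀ hU0]
      field_simp
      linarith
    refine le_trans ?_ this
    have : u / numUpTo S t ≤ u / (n * r) := by gcongr
    linarith
  have k3 : (B / numUpTo S t - A / numAfter S t) * (1 / 2 * (Q - P)) ≤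
      (1 - mismatch S t₀ t) * Δ :=
    (mul_le_mul_of_nonneg_left hPQ hw.1).trans (mul_le_mul_of_nonneg_right hw.2 hΔ)
  linarith

end

/-! ### The plug-in statistic given the arrival times. -/

section

variable {X : Type*} [MeasurableSpace X] {𝒯 : Set ℝ} {n : ℕ}

theorem IsEstimator.measurable_comp {d : Statistic X 𝒯} (hd : IsEstimator d) {Ω : Type*}
    [MeasurableSpace Ω] {f : Ω → Fin n → 𝒯 × X} {g : Ω → 𝒯} (hf : Measurable f)
    (hg : Measurable g) : Measurable fun ω => d n (f ω) (g ω) :=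
  (hd n).comp (hf.prodMk hg)

theorem measurable_afterLabel : Measurable fun z : 𝒯 × 𝒯 => afterLabel z.1 z.2 := by
  refine measurable_to_bool ?_
  have : (fun z : 𝒯 × 𝒯 => afterLabel z.1 z.2) ⁻¹' {true} = {z | z.1 < z.2} := by
    ext z; simp [afterLabel]
  rw [this]
  exact measurableSet_lt measurable_fst measurable_snd

theorem measurable_labelFreq :
    Measurable fun z : (Fin n → 𝒯 × X) × 𝒯 => labelFreq z.1 z.2 false := by
  simp only [labelFreq_false, numUpTo]
  refine Measurable.div_const (Finset.measurable_sum _ fun i _ => ?_) _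
  exact Measurable.ite (measurableSet_lt measurable_snd
    (measurable_fst.comp ((measurable_pi_apply i).comp measurable_fst)))
    measurable_const measurable_const

theorem measurable_mismatch (t₀ : 𝒯) :
    Measurable fun z : (Fin n → 𝒯 × X) × 𝒯 => mismatch z.1 t₀ z.2 := by
  refine Measurable.div_const (Finset.measurable_sum _ fun i _ => ?_) _
  have hi : Measurable fun z : (Fin n → 𝒯 × X) × 𝒯 => (z.1 i).1 :=
    measurable_fst.comp ((measurable_pi_apply i).comp measurable_fst)
  exact Measurable.ite (measurableSet_eq_fun
    (measurable_afterLabel.comp (measurable_snd.prodMk hi))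
    (measurable_afterLabel.comp (measurable_const.prodMk hi)))
    measurable_const measurable_const

theorem measurableSet_isTrimmed (r : ℝ) :
    MeasurableSet {z : (Fin n → 𝒯 × X) × 𝒯 | IsTrimmed r z.1 z.2} :=
  (measurableSet_le measurable_const measurable_labelFreq).inter
    (measurableSet_lt measurable_labelFreq measurable_const)

theorem isEstimator_inducedEstimator {H : Set (X → Bool)} (hmeas : IsEstimator (plugIn H 𝒯))
    (τ ε : ℕ → ℝ) : IsEstimator (inducedEstimator H 𝒯 τ ε) := fun n =>
  Measurable.ite (measurableSet_isTrimmed (τ n))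
    (((hmeas n).sub_const _).max measurable_const) measurable_const

/-- The uniform upper bound for the plug-in statistic, conditionally on the arrival times. -/
theorem measure_lt_plugIn_le {H : Set (X → Bool)} (hne : H.Nonempty)
    (hH : ∀ h ∈ H, Measurable h) (hmeas : IsEstimator (plugIn H 𝒯)) {d : ℕ}
    (hd : ∀ x : Fin d → X, ¬ ShattersPoints H x)
    (P Q : Measure X) [IsProbabilityMeasure P] [IsProbabilityMeasure Q] (t₀ : 𝒯)
    {Δ : ℝ} (hΔ : 0 ≤ Δ)
    (hPQ : ∀ h ∈ H, 1 / 2 * (∫ x, labelValue (h x) ∂Q - ∫ x, labelValue (h x) ∂P) ≤ Δ)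
    {r u : ℝ} (hr : 0 < r) (hu : 0 < u) (hun : 8 * n ≤ u ^ 2) (T : Fin n → 𝒯) :
    (Measure.pi fun i => if T i ≤ t₀ then P else Q) {x | ∃ j,
        IsTrimmed r (fun i => (T i, x i)) (T j) ∧
        (1 - mismatch (fun i => (T i, x i)) t₀ (T j)) * Δ + u / (n * r)
          < plugIn H 𝒯 n (fun i => (T i, x i)) (T j)}
      ≤ ENNReal.ofReal
        (n * (4 * ((d + 1) * (2 * n + 1) ^ d * Real.exp (-(u ^ 2 / (8 * n)))))) := by
  set κ : Fin n → Measure X := fun i => if T i ≤ t₀ then P else Q with hκ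
  have hprob : ∀ i, IsProbabilityMeasure (κ i) := fun i => by
    simp only [hκ]; split_ifs <;> infer_instance
  set K : ℝ := 2 * ((d + 1) * (2 * n + 1) ^ d * Real.exp (-(u ^ 2 / (8 * n)))) with hK
  have hK0 : 0 ≤ K := by positivity
  have hj : ∀ j, Measure.pi κ {x | IsTrimmed r (fun i => (T i, x i)) (T j) ∧
        (1 - mismatch (fun i => (T i, x i)) t₀ (T j)) * Δ + u / (n * r)
          < plugIn H 𝒯 n (fun i => (T i, x i)) (T j)} ≤ ENNReal.ofReal (2 * K) := by
    intro j
    -- A split with nothing after it is not trimmed. Otherwise `T j < T k` are the two distinct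
    -- times which the measurability argument in the deviation inequality needs.
    by_cases hst : ∃ k, T j < T k
    swap
    · refine le_of_eq_of_le ?_ zero_le
      convert! measure_empty (μ := Measure.pi κ)
      refine Set.eq_empty_of_forall_notMem fun x hx => hst ?_
      have hn := hx.1.size_pos hr
      exact exists_lt_of_numAfter_pos ((mul_pos hn hr).trans_le (hx.1.le_numAfter hr))
    obtain ⟨k, hst⟩ := hst
    -- The two sign patterns control a sum after the split that is too large and a sum up to it that
    -- is too small.
    have b1 := measure_exists_deviation_le hne hH hmeas hst hd κ
      (fun i => if T j < T i then (1 : ℝ) else 0) (fun i => by split_ifs <;> simp) hu hun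
    have b2 := measure_exists_deviation_le hne hH hmeas hst hd κ
      (fun i => if T j < T i then (0 : ℝ) else -1) (fun i => by split_ifs <;> simp) hu hun
    rw [two_mul, ENNReal.ofReal_add hK0 hK0]
    refine le_trans (measure_mono ?_) ((measure_union_le _ _).trans (add_le_add b1 b2))
    rintro x ⟨htr, hlt⟩
    obtain ⟨h, hh, hlt⟩ := (lt_plugIn_iff hne _ _ _).1 hlt
    by_contra hcon
    simp only [Set.mem_union, Set.mem_ofPred_eq, not_or, not_exists, not_and, not_lt] at hcon
    have hint : ∀ i, ∫ y, labelValue (h y) ∂κ i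
        = if T i ≤ t₀ then ∫ y, labelValue (h y) ∂P else ∫ y, labelValue (h y) ∂Q := by
      intro i; simp only [hκ]; split_ifs <;> rfl
    refine hlt.not_ge (half_sub_empiricalRisk_le hr hu.le htr hΔ (hPQ h hh) ?_ ?_)
    · simpa only [hint] using hcon.1 h hh
    · simpa only [hint] using hcon.2 h hh
  calc _ ≤ ∑ j, Measure.pi κ {x | IsTrimmed r (fun i => (T i, x i)) (T j) ∧
        (1 - mismatch (fun i => (T i, x i)) t₀ (T j)) * Δ + u / (n * r)
          < plugIn H 𝒯 n (fun i => (T i, x i)) (T j)} := by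
        rw [Set.ofPred_exists]
        exact measure_iUnion_fintype_le _ _
    _ ≤ ∑ _j : Fin n, ENNReal.ofReal (2 * K) := Finset.sum_le_sum fun j _ => hj j
    _ = _ := by
        rw [Finset.sum_const, Finset.card_univ, Fintype.card_fin, nsmul_eq_mul,
          ENNReal.ofReal_mul (Nat.cast_nonneg n), ENNReal.ofReal_natCast, hK, ← mul_assoc 2 2]
        norm_num

/-- A bound for a two-phase drift process which holds conditionally on the arrival times. -/
theorem windowLaw_le_of_forall {PT : Measure 𝒯} [IsProbabilityMeasure PT] {p : Kernel 𝒯 X}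
    [IsMarkovKernel p] {P Q : Measure X} [IsProbabilityMeasure P] [IsProbabilityMeasure Q]
    {t₀ : 𝒯} (hp : ∀ t, p t = if t ≤ t₀ then P else Q) {E : Set (Fin n → 𝒯 × X)}
    (hE : MeasurableSet E) {δ : ℝ≥0∞}
    (hδ : ∀ T : Fin n → 𝒯, (Measure.pi fun i => if T i ≤ t₀ then P else Q)
      {x | (fun i => (T i, x i)) ∈ E} ≤ δ) : windowLaw PT p n E ≤ δ := by
  classical
  -- Draw one observation from each phase, independently of the time, and let the time select one of
  -- them. This makes the window a function of product variables, so Fubini's theorem replaces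
  -- conditioning.
  let sel : 𝒯 → X × X → X := fun t z => if t ≤ t₀ then z.1 else z.2
  let φ : 𝒯 × (X × X) → 𝒯 × X := fun z => (z.1, sel z.1 z.2)
  have hφ : Measurable φ := by
    refine measurable_fst.prodMk (Measurable.ite (measurableSet_le measurable_fst measurable_const)
      ?_ ?_) <;> fun_prop
  have hsel : ∀ t, Measurable (sel t) := fun t => by
    by_cases h : t ≤ t₀
    · simpa only [sel, h, if_true] using measurable_fst
    · simpa only [sel, h, if_false] using measurable_snd
  have hmap : ∀ t, (P.prod Q).map (sel t) = if t ≤ t₀ then P else Q := fun t => by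
    by_cases h : t ≤ t₀
    · simp only [sel, h, if_true]
      exact measurePreserving_fst.map_eq
    · simp only [sel, h, if_false]
      exact measurePreserving_snd.map_eq
  have hlaw : PT ⊗ₘ p = (PT.prod (P.prod Q)).map φ := by
    ext B hB
    rw [Measure.compProd_apply hB, Measure.map_apply hφ hB, Measure.prod_apply (hφ hB)]
    refine lintegral_congr fun t => ?_
    rw [hp, ← hmap, Measure.map_apply (hsel t) (measurable_prodMk_left hB)]
    rfl
  have hprobφ : IsProbabilityMeasure ((PT.prod (P.prod Q)).map φ) :=
    Measure.isProbabilityMeasure_map hφ.aemeasurable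
  have hψ : Measurable fun (z : Fin n → 𝒯 × (X × X)) i => φ (z i) := by fun_prop
  rw [windowLaw, hlaw, ← Measure.pi_map_pi fun _ => hφ.aemeasurable, Measure.map_apply hψ hE]
  set e := MeasurableEquiv.arrowProdEquivProdArrow 𝒯 (X × X) (Fin n) with he
  have hmp := measurePreserving_arrowProdEquivProdArrow 𝒯 (X × X) (Fin n) (fun _ => PT)
    (fun _ => P.prod Q)
  rw [← (hmp.symm e).measure_preimage (hψ hE).nullMeasurableSet,
    Measure.prod_apply (e.symm.measurable (hψ hE))]
  calc _ ≤ ∫⁻ _, δ ∂(Measure.pi fun _ : Fin n => PT) := by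
        refine lintegral_mono fun T => ?_
        refine le_trans (le_of_eq ?_) (hδ T)
        have hET : MeasurableSet {x : Fin n → X | (fun i => (T i, x i)) ∈ E} := by
          refine (show Measurable fun (x : Fin n → X) i => (T i, x i) from ?_) hE
          fun_prop
        have hprob : ∀ i, IsProbabilityMeasure ((P.prod Q).map (sel (T i))) := fun i =>
          Measure.isProbabilityMeasure_map (hsel (T i)).aemeasurable
        simp only [← hmap]
        rw [← Measure.pi_map_pi fun i => (hsel (T i)).aemeasurable, Measure.map_apply _ hET]
        · rfl
        · exact measurable_pi_lambda _ fun i => (hsel (T i)).comp (measurable_pi_apply i)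
    _ = δ := by simp

end

/-! ### The rate condition and the upper bound with high probability. -/

section

/-- The sample sizes from which on the deviation bound is effective. -/
theorem eventually_rate {τ ε : ℕ → ℝ}
    (hrate : Tendsto (fun n : ℕ => ε n * τ n * √((n : ℝ) / Real.log n)) atTop atTop) (d : ℕ)
    {δ : ℝ} (hδ : 0 < δ) : ∀ᶠ n : ℕ in atTop, 0 < n ∧
      8 * (n : ℝ) ≤ (n * τ n * ε n / 2) ^ 2 ∧
      n * (4 * ((d + 1) * (2 * n + 1) ^ d *
        Real.exp (-((n * τ n * ε n / 2) ^ 2 / (8 * n))))) ≤ δ := by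
  set C : ℝ := 4 * ((d + 1) * 3 ^ d) with hC
  have hC0 : 0 < C := by positivity
  -- With this constant, `u ^ 2 / (8 * n) = n * (ε n * τ n) ^ 2 / 32` for `u = n * τ n * ε n / 2` is
  -- at least `(d + 2) * log n`. The exponential is then at most `n ^ (-(d + 2))`, which beats the
  -- growth `n * n ^ d` and leaves `C / n`.
  filter_upwards [hrate.eventually_ge_atTop (√(32 * (d + 2))), eventually_ge_atTop 3,
    (tendsto_natCast_atTop_atTop (R := ℝ)).eventually_ge_atTop (C / δ)] with n hn hn3 hnδ
  have hn' : (3 : ℝ) ≤ n := by exact_mod_cast hn3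
  have hn0 : (0 : ℝ) < n := by linarith
  have hlog : 1 ≤ Real.log n := by
    rw [Real.le_log_iff_exp_le hn0]
    exact (Real.exp_one_lt_d9.le.trans (by norm_num)).trans hn'
  have hsq : 32 * (d + 2) * Real.log n ≤ n * (ε n * τ n) ^ 2 := by
    have h1 : (√(32 * (d + 2) : ℝ)) ^ 2 ≤ (ε n * τ n * √((n : ℝ) / Real.log n)) ^ 2 :=
      pow_le_pow_left₀ (Real.sqrt_nonneg _) hn 2
    rw [Real.sq_sqrt (by positivity), mul_pow, Real.sq_sqrt (by positivity), ← mul_div_assoc,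
      le_div_iff₀ (by linarith)] at h1
    linarith
  have hu : (n * τ n * ε n / 2) ^ 2 = n * (n * (ε n * τ n) ^ 2) / 4 := by ring
  refine ⟨by omega, ?_, ?_⟩
  · rw [hu]
    have hd0 : (0 : ℝ) ≤ d := Nat.cast_nonneg d
    have : 32 ≤ n * (ε n * τ n) ^ 2 := by nlinarith
    nlinarith
  · have hexp : Real.exp (-((n * τ n * ε n / 2) ^ 2 / (8 * n))) ≤ ((n : ℝ) ^ (d + 2))⁻¹ := by
      rw [← Real.exp_log (pow_pos hn0 (d + 2)), ← Real.exp_neg, Real.exp_le_exp, neg_le_neg_iff,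
        Real.log_pow, hu, le_div_iff₀ (by positivity)]
      push_cast
      nlinarith
    have hpow : (2 * (n : ℝ) + 1) ^ d ≤ 3 ^ d * (n : ℝ) ^ d := by
      rw [← mul_pow]
      exact pow_le_pow_left₀ (by positivity) (by linarith) d
    calc _ ≤ n * (4 * ((d + 1) * (3 ^ d * (n : ℝ) ^ d) * ((n : ℝ) ^ (d + 2))⁻¹)) := by gcongr
      _ = C / n := by rw [hC]; field_simp; ring
      _ ≤ δ := by
        rw [div_le_iff₀ hn0]
        rwa [div_le_iff₀ hδ, mul_comm] at hnδ

variable {X : Type*} [MeasurableSpace X] {𝒯 : Set ℝ}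

/-- With high probability, the plug-in statistic of a two-phase drift process is at most the
discrepancy `Δ` of the phases, discounted by the mismatch of the split, up to half the threshold. -/
theorem eventually_windowLaw_lt_plugIn_le {H : Set (X → Bool)} (hne : H.Nonempty)
    (hH : ∀ h ∈ H, Measurable h) (hmeas : IsEstimator (plugIn H 𝒯)) (hPAC : IsPACLearnable H)
    {τ ε : ℕ → ℝ} (hτ : ∀ n, 0 < τ n) (hε : ∀ n, 0 < ε n)
    (hrate : Tendsto (fun n : ℕ => ε n * τ n * √((n : ℝ) / Real.log n)) atTop atTop)
    {PT : Measure 𝒯} [IsProbabilityMeasure PT] {p : Kernel 𝒯 X}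
    [IsMarkovKernel p] {P Q : Measure X} [IsProbabilityMeasure P] [IsProbabilityMeasure Q]
    {t₀ : 𝒯} (hp : ∀ t, p t = if t ≤ t₀ then P else Q) {Δ : ℝ} (hΔ : 0 ≤ Δ)
    (hPQ : ∀ h ∈ H, 1 / 2 * (∫ x, labelValue (h x) ∂Q - ∫ x, labelValue (h x) ∂P) ≤ Δ)
    {δ : ℝ} (hδ : 0 < δ) :
    ∀ᶠ n : ℕ in atTop, windowLaw PT p n {S | ∃ t, IsTrimmed (τ n) S t ∧
      (1 - mismatch S t₀ t) * Δ + ε n / 2 < plugIn H 𝒯 n S t} ≤ ENNReal.ofReal δ := by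
  obtain ⟨d, hd⟩ := hPAC.exists_not_shattersPoints
  filter_upwards [eventually_rate hrate d hδ] with n ⟨hn, hun, hnδ⟩
  have hn0 : (0 : ℝ) < n := by exact_mod_cast hn
  have hτn := hτ n
  have hεn := hε n
  set u := n * τ n * ε n / 2 with hu
  have hu0 : 0 < u := by positivity
  have hur : u / (n * τ n) = ε n / 2 := by rw [hu]; field_simp
  -- Restricting to splits at arrival times turns an uncountable union into a finite one, hence a
  -- measurable event. Nothing is lost, as the statistic depends on `t` only through the labels.
  set E : Set (Fin n → 𝒯 × X) := {S | ∃ j, IsTrimmed (τ n) S (S j).1 ∧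
      (1 - mismatch S t₀ (S j).1) * Δ + u / (n * τ n) < plugIn H 𝒯 n S (S j).1} with hE
  have hEm : MeasurableSet E := by
    rw [hE, Set.ofPred_exists]
    refine MeasurableSet.iUnion fun j => ?_
    have hj : Measurable fun S : Fin n → 𝒯 × X => (S, (S j).1) :=
      measurable_id.prodMk (measurable_fst.comp (measurable_pi_apply j))
    have h1 : MeasurableSet {S : Fin n → 𝒯 × X | IsTrimmed (τ n) S (S j).1} :=
      hj (measurableSet_isTrimmed (τ n))
    have h2 : Measurable fun S : Fin n → 𝒯 × X => mismatch S t₀ (S j).1 :=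
      (measurable_mismatch t₀).comp hj
    have h3 : Measurable fun S : Fin n → 𝒯 × X => plugIn H 𝒯 n S (S j).1 :=
      hmeas.measurable_comp measurable_id (measurable_fst.comp (measurable_pi_apply j))
    exact h1.inter (measurableSet_lt (((h2.const_sub 1).mul_const Δ).add_const _) h3)
  have hEle : windowLaw PT p n E ≤ ENNReal.ofReal δ := by
    refine windowLaw_le_of_forall hp hEm fun T => ?_
    refine le_trans ?_ (ENNReal.ofReal_le_ofReal hnδ)
    exact measure_lt_plugIn_le hne hH hmeas hd P Q t₀ hΔ hPQ hτn hu0 hun T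
  refine le_trans (measure_mono ?_) hEle
  rintro S ⟨t, ht, hlt⟩
  obtain ⟨j, hj⟩ := exists_afterLabel_eq
    ((mul_pos (ht.size_pos hτn) hτn).trans_le (ht.le_numUpTo hτn))
  refine ⟨j, ?_, ?_⟩
  · rw [IsTrimmed, ← labelFreq_congr hj]; exact ht
  · rw [hur, ← mismatch_congr t₀ hj, ← plugIn_congr H hj]; exact hlt

end

/-! ### Chains of intervals and laws of large numbers. -/

section

/-- Every separable linear order has a coinitial sequence. -/
theorem exists_coinitial_seq (α : Type*) [LinearOrder α] [TopologicalSpace α]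
    [OrderClosedTopology α] [TopologicalSpace.SeparableSpace α] [Nonempty α] :
    ∃ u : ℕ → α, ∀ t, ∃ k, u k ≤ t := by
  by_cases h : ∃ m : α, ∀ t, m ≤ t
  · obtain ⟨m, hm⟩ := h
    exact ⟨fun _ => m, fun t => ⟨0, hm t⟩⟩
  · push Not at h
    refine ⟨TopologicalSpace.denseSeq α, fun t => ?_⟩
    obtain ⟨k, hk⟩ := (TopologicalSpace.denseRange_denseSeq α).exists_mem_open
      (isOpen_Iio (a := t)) (h t)
    exact ⟨k, le_of_lt hk⟩

theorem exists_coinitial_seq_of_nonempty {𝒯 : Set ℝ} {U : Set 𝒯} (hU : U.Nonempty) :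
    ∃ u : ℕ → 𝒯, (∀ k, u k ∈ U) ∧ ∀ t ∈ U, ∃ k, u k ≤ t := by
  have := hU.to_subtype
  obtain ⟨u, hu⟩ := exists_coinitial_seq U
  exact ⟨fun k => u k, fun k => (u k).2, fun t ht => hu ⟨t, ht⟩⟩

theorem exists_cofinal_seq_of_nonempty {𝒯 : Set ℝ} {U : Set 𝒯} (hU : U.Nonempty) :
    ∃ u : ℕ → 𝒯, (∀ k, u k ∈ U) ∧ ∀ t ∈ U, ∃ k, t ≤ u k := by
  have := hU.to_subtype
  have : Nonempty (↥U)ᵒᵈ := ‹Nonempty ↥U›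
  have : TopologicalSpace.SeparableSpace (↥U)ᵒᵈ :=
    inferInstanceAs (TopologicalSpace.SeparableSpace ↥U)
  obtain ⟨u, hu⟩ := exists_coinitial_seq (↥U)ᵒᵈ
  exact ⟨fun k => (OrderDual.ofDual (u k) : ↥U), fun k => (OrderDual.ofDual (u k) : ↥U).2,
    fun t ht => hu (OrderDual.toDual ⟨t, ht⟩)⟩

/-- A chain of events with a coinitial sequence, each of measure at least `c`, contains a common
event of measure at least `c`. -/
theorem exists_common_subset {α ι : Type*} [MeasurableSpace α] {μ : Measure α} [IsFiniteMeasure μ]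
    {f : ι → Set α} (hf : ∀ i, MeasurableSet (f i)) {U : Set ι} {u : ℕ → ι} (huU : ∀ k, u k ∈ U)
    (hu : ∀ i ∈ U, ∃ k, f (u k) ⊆ f i) (hchain : ∀ i ∈ U, ∀ j ∈ U, f i ⊆ f j ∨ f j ⊆ f i)
    {c : ℝ≥0∞} (hc : ∀ i ∈ U, c ≤ μ (f i)) :
    ∃ C, MeasurableSet C ∧ c ≤ μ C ∧ ∀ i ∈ U, C ⊆ f i := by
  refine ⟨⋂ k, f (u k), MeasurableSet.iInter fun k => hf _, ?_, fun i hi => ?_⟩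
  · have hdir : Directed (· ⊇ ·) fun k => f (u k) := by
      intro k l
      rcases hchain _ (huU k) _ (huU l) with h | h
      · exact ⟨k, subset_rfl, h⟩
      · exact ⟨l, h, subset_rfl⟩
    rw [hdir.measure_iInter (fun k => (hf _).nullMeasurableSet) ⟨0, measure_ne_top _ _⟩]
    exact le_iInf fun k => hc _ (huU k)
  · obtain ⟨k, hk⟩ := hu i hi
    exact (Set.iInter_subset _ k).trans hk

end

section

variable {X : Type*} [MeasurableSpace X] {𝒯 : Set ℝ}

/-- The weak law of large numbers for windows. -/
theorem eventually_windowLaw_abs_sub_ge_le (PT : Measure 𝒯) [IsProbabilityMeasure PT]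
    (p : Kernel 𝒯 X) [IsMarkovKernel p] {g : 𝒯 × X → ℝ} (hg : Measurable g)
    (hb : ∀ z, |g z| ≤ 1) {η δ : ℝ} (hη : 0 < η) (hδ : 0 < δ) :
    ∀ᶠ n : ℕ in atTop, windowLaw PT p n
      {S | η ≤ |(∑ i, g (S i)) / n - ∫ z, g z ∂(PT ⊗ₘ p)|} ≤ ENNReal.ofReal δ := by
  filter_upwards [eventually_gt_atTop 0,
    (tendsto_natCast_atTop_atTop (R := ℝ)).eventually_ge_atTop (1 / (η ^ 2 * δ))] with n hn hnδ
  have hn' : (0 : ℝ) < n := by exact_mod_cast hn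
  have h := measure_pi_abs_sum_sub_ge_le (fun _ : Fin n => PT ⊗ₘ p) (fun _ => g) (fun _ => hg)
    (fun _ => hb) (mul_pos hn' hη)
  refine (measure_mono ?_).trans (h.trans (ENNReal.ofReal_le_ofReal ?_))
  · intro S hS
    simp only [Set.mem_ofPred_eq, Finset.sum_const, Finset.card_univ, Fintype.card_fin,
      nsmul_eq_mul] at hS ⊢
    have : ∑ i, g (S i) - n * ∫ z, g z ∂(PT ⊗ₘ p)
        = n * ((∑ i, g (S i)) / n - ∫ z, g z ∂(PT ⊗ₘ p)) := by field_simp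
    rw [this, abs_mul, abs_of_pos hn']
    gcongr
  · rw [Fintype.card_fin, div_le_iff₀ (by positivity)]
    rw [div_le_iff₀ (by positivity)] at hnδ
    nlinarith

/-- With high probability, every split which is far from `t₀` in probability has a large
mismatch with `t₀`. -/
theorem eventually_windowLaw_mismatch_lt_le (PT : Measure 𝒯) [IsProbabilityMeasure PT]
    (p : Kernel 𝒯 X) [IsMarkovKernel p] (t₀ : 𝒯) {ε δ : ℝ} (hε : 0 < ε) (hδ : 0 < δ) :
    ∀ᶠ n : ℕ in atTop, windowLaw PT p n
      {S | ∃ t, ε ≤ PT.real (Set.uIoc t₀ t) ∧ mismatch S t₀ t < ε / 2} ≤ ENNReal.ofReal δ := by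
  classical
  -- On one side of `t₀` the far intervals form a chain and share a set `C` of mass at least `ε`.
  -- The weak law for this single set then bounds the mismatch of all far splits at once.
  have key : ∀ U : Set 𝒯, (∀ t ∈ U, ε ≤ PT.real (Set.uIoc t₀ t)) →
      (U.Nonempty → ∃ u : ℕ → 𝒯, (∀ k, u k ∈ U) ∧
        ∀ t ∈ U, ∃ k, Set.uIoc t₀ (u k) ⊆ Set.uIoc t₀ t) →
      (∀ s ∈ U, ∀ t ∈ U, Set.uIoc t₀ s ⊆ Set.uIoc t₀ t ∨ Set.uIoc t₀ t ⊆ Set.uIoc t₀ s) →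
      ∀ᶠ n : ℕ in atTop, windowLaw PT p n
        {S | ∃ t ∈ U, mismatch S t₀ t < ε / 2} ≤ ENNReal.ofReal (δ / 2) := by
    intro U hUε hseq hchain
    rcases U.eq_empty_or_nonempty with rfl | hU
    · simp
    obtain ⟨u, huU, hu⟩ := hseq hU
    obtain ⟨C, hCm, hC, hCU⟩ := exists_common_subset (μ := PT) (f := fun t => Set.uIoc t₀ t)
      (fun t => measurableSet_uIoc) huU hu hchain (c := ENNReal.ofReal ε) fun t ht =>
        ENNReal.ofReal_le_of_le_toReal (hUε t ht)
    have hCε : ε ≤ PT.real C := (ENNReal.ofReal_le_iff_le_toReal (measure_ne_top _ _)).1 hC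
    have hB : MeasurableSet (Prod.fst ⁻¹' C : Set (𝒯 × X)) := measurable_fst hCm
    filter_upwards [eventually_windowLaw_abs_sub_ge_le PT p
      (g := (Prod.fst ⁻¹' C : Set (𝒯 × X)).indicator 1) (measurable_one.indicator hB)
      (fun z => by by_cases h : z.1 ∈ C <;> simp [h]) (half_pos hε) (half_pos hδ)] with n hn
    refine (measure_mono ?_).trans hn
    rintro S ⟨t, htU, ht⟩
    have hint : ∫ z, (Prod.fst ⁻¹' C : Set (𝒯 × X)).indicator 1 z ∂(PT ⊗ₘ p) = PT.real C := by
      rw [integral_indicator_one hB, measureReal_def, ← Measure.fst_apply hCm,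
        Measure.fst_compProd, measureReal_def]
    have hle : (∑ i, (Prod.fst ⁻¹' C : Set (𝒯 × X)).indicator 1 (S i)) / n
        ≤ mismatch S t₀ t := by
      refine div_le_div_of_nonneg_right (Finset.sum_le_sum fun i _ => ?_) (Nat.cast_nonneg n)
      by_cases hi : (S i).1 ∈ C
      · have := hCU t htU hi
        rw [if_neg]
        · simp [hi]
        · rw [Set.mem_uIoc] at this
          simp only [afterLabel, decide_eq_decide]
          rcases this with h | h
          · simp [h.1, h.2.not_gt]
          · simp [h.1, h.2.not_gt]
      · rw [Set.indicator_of_notMem (by simpa using hi)]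
        split_ifs <;> norm_num
    simp only [Set.mem_ofPred_eq, hint]
    rw [abs_sub_comm]
    refine le_trans ?_ (le_abs_self _)
    linarith
  have hR := key {t | t₀ ≤ t ∧ ε ≤ PT.real (Set.uIoc t₀ t)} (fun t ht => ht.2) (fun hU => by
      obtain ⟨u, huU, hu⟩ := exists_coinitial_seq_of_nonempty hU
      refine ⟨u, huU, fun t ht => (hu t ht).imp fun k hk => ?_⟩
      rw [Set.uIoc_of_le (huU k).1, Set.uIoc_of_le ht.1]
      exact Set.Ioc_subset_Ioc_right hk) (fun s hs t ht => by
      rw [Set.uIoc_of_le hs.1, Set.uIoc_of_le ht.1]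
      exact (le_total s t).imp Set.Ioc_subset_Ioc_right Set.Ioc_subset_Ioc_right)
  have hL := key {t | t ≤ t₀ ∧ ε ≤ PT.real (Set.uIoc t₀ t)} (fun t ht => ht.2) (fun hU => by
      obtain ⟨u, huU, hu⟩ := exists_cofinal_seq_of_nonempty hU
      refine ⟨u, huU, fun t ht => (hu t ht).imp fun k hk => ?_⟩
      rw [Set.uIoc_of_ge (huU k).1, Set.uIoc_of_ge ht.1]
      exact Set.Ioc_subset_Ioc_left hk) (fun s hs t ht => by
      rw [Set.uIoc_of_ge hs.1, Set.uIoc_of_ge ht.1]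
      exact (le_total t s).imp Set.Ioc_subset_Ioc_left Set.Ioc_subset_Ioc_left)
  filter_upwards [hR, hL] with n h1 h2
  rw [← add_halves δ, ENNReal.ofReal_add (half_pos hδ).le (half_pos hδ).le]
  refine (measure_mono ?_).trans ((measure_union_le _ _).trans (add_le_add h1 h2))
  rintro S ⟨t, ht, hlt⟩
  rcases le_total t₀ t with h | h
  · exact Or.inl ⟨t, ⟨h, ht⟩, hlt⟩
  · exact Or.inr ⟨t, ⟨h, ht⟩, hlt⟩

/-- With high probability, the split at a fixed `t` is admissible and the empirical risk of a fixed
classifier is at most its risk, up to `η`. -/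
theorem eventually_windowLaw_risk_le {τ : ℕ → ℝ} (hτ0 : Tendsto τ atTop (𝓝 0))
    (PT : Measure 𝒯) [IsProbabilityMeasure PT] (p : Kernel 𝒯 X) [IsMarkovKernel p] (t : 𝒯)
    {h : X → Bool} (hh : Measurable h) {α β a b : ℝ} (hα0 : 0 < α) (hβ0 : 0 < β)
    (hα : ∫ z : 𝒯 × X, (if t < z.1 then 1 else 0) ∂(PT ⊗ₘ p) = α)
    (hβ : ∫ z : 𝒯 × X, (if t < z.1 then 0 else 1) ∂(PT ⊗ₘ p) = β)
    (ha : ∫ z : 𝒯 × X, (if t < z.1 then labelValue (h z.2) else 0) ∂(PT ⊗ₘ p) = a)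
    (hb : ∫ z : 𝒯 × X, (if t < z.1 then 0 else labelValue (h z.2)) ∂(PT ⊗ₘ p) = b)
    {η δ : ℝ} (hη : 0 < η) (hδ : 0 < δ) :
    ∀ᶠ n : ℕ in atTop, windowLaw PT p n {S | ¬ (IsTrimmed (τ n) S t ∧
      1 / 2 * (a / α - b / β) - η < 1 / 2 - empiricalRisk S t h)} ≤ ENNReal.ofReal δ := by
  have hcont : ContinuousAt (fun y : ℝ × ℝ × ℝ × ℝ => 1 / 2 * (y.1 / y.2.1 - y.2.2.1 / y.2.2.2))
      (a, α, b, β) := by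
    refine ContinuousAt.mul continuousAt_const (ContinuousAt.sub ?_ ?_) <;>
      refine ContinuousAt.div (by fun_prop) (by fun_prop) ?_
    · exact hα0.ne'
    · exact hβ0.ne'
  obtain ⟨ρ, hρ0, hρ⟩ := Metric.eventually_nhds_iff.1 (hcont.eventually (lt_mem_nhds
    (show 1 / 2 * (a / α - b / β) - η < 1 / 2 * (a / α - b / β) by linarith)))
  -- The bounds `α / 2` and `β / 2` keep both sides of the split above the fraction `r`, hence
  -- eventually above `τ n`; `ρ` comes from continuity of the quotients.
  set r := min ρ (min (α / 2) (β / 2)) with hr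
  have hr0 : 0 < r := by positivity
  have hms : MeasurableSet {z : 𝒯 × X | t < z.1} := measurableSet_lt measurable_const measurable_fst
  have hm : Measurable fun z : 𝒯 × X => labelValue (h z.2) :=
    measurable_labelValue.comp (hh.comp measurable_snd)
  have hlv : ∀ b, |labelValue b| ≤ 1 := fun b => by
    rw [abs_of_nonneg (labelValue_nonneg b)]; exact labelValue_le_one b
  have e1 := eventually_windowLaw_abs_sub_ge_le PT p
    (g := fun z => if t < z.1 then 1 else 0) (Measurable.ite hms measurable_const measurable_const)
    (fun z => by split_ifs <;> simp) hr0 (show 0 < δ / 4 by positivity)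
  have e2 := eventually_windowLaw_abs_sub_ge_le PT p
    (g := fun z => if t < z.1 then 0 else 1) (Measurable.ite hms measurable_const measurable_const)
    (fun z => by split_ifs <;> simp) hr0 (show 0 < δ / 4 by positivity)
  have e3 := eventually_windowLaw_abs_sub_ge_le PT p
    (g := fun z => if t < z.1 then labelValue (h z.2) else 0) (Measurable.ite hms hm measurable_const)
    (fun z => by split_ifs <;> simp [hlv]) hr0 (show 0 < δ / 4 by positivity)
  have e4 := eventually_windowLaw_abs_sub_ge_le PT p
    (g := fun z => if t < z.1 then 0 else labelValue (h z.2)) (Measurable.ite hms measurable_const hm)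
    (fun z => by split_ifs <;> simp [hlv]) hr0 (show 0 < δ / 4 by positivity)
  rw [hα] at e1
  rw [hβ] at e2
  rw [ha] at e3
  rw [hb] at e4
  filter_upwards [e1, e2, e3, e4, eventually_gt_atTop 0, hτ0.eventually (gt_mem_nhds hr0)]
    with n h1 h2 h3 h4 hn hτn
  have hn' : (0 : ℝ) < n := by exact_mod_cast hn
  have hsum : ENNReal.ofReal δ = ENNReal.ofReal (δ / 4) + ENNReal.ofReal (δ / 4)
      + (ENNReal.ofReal (δ / 4) + ENNReal.ofReal (δ / 4)) := by
    rw [← ENNReal.ofReal_add (by positivity) (by positivity),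
      ← ENNReal.ofReal_add (by positivity) (by positivity)]
    congr 1; ring
  rw [hsum]
  refine (measure_mono ?_).trans ((measure_union_le _ _).trans (add_le_add
    ((measure_union_le _ _).trans (add_le_add h1 h2))
    ((measure_union_le _ _).trans (add_le_add h3 h4))))
  intro S hS
  by_contra hcon
  simp only [Set.mem_union, Set.mem_ofPred_eq, not_or, not_le] at hcon
  obtain ⟨⟨k1, k2⟩, k3, k4⟩ := hcon
  change |numAfter S t / n - α| < r at k1
  change |numUpTo S t / n - β| < r at k2
  change |sumAfter S t h / n - a| < r at k3
  change |sumUpTo S t h / n - b| < r at k4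
  have hrα : r ≤ α / 2 := (min_le_right _ _).trans (min_le_left _ _)
  have hrβ : r ≤ β / 2 := (min_le_right _ _).trans (min_le_right _ _)
  have hrρ : r ≤ ρ := min_le_left _ _
  have l1 := abs_lt.1 k1
  have l2 := abs_lt.1 k2
  have hsum1 : numAfter S t / n + numUpTo S t / n = 1 := by
    rw [← add_div, numAfter_add_numUpTo, div_self hn'.ne']
  have hA : 0 < numAfter S t / n := by linarith
  have hU : 0 < numUpTo S t / n := by linarith
  refine hS ⟨⟨?_, ?_⟩, ?_⟩
  · rw [labelFreq_false]; linarith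
  · rw [labelFreq_false]; linarith
  · have hd : dist (sumAfter S t h / n, numAfter S t / n, sumUpTo S t h / n, numUpTo S t / n)
        (a, α, b, β) < ρ := by
      simp only [Prod.dist_eq, Real.dist_eq, max_lt_iff]
      exact ⟨k3.trans_le hrρ, k1.trans_le hrρ, k4.trans_le hrρ, k2.trans_le hrρ⟩
    have := hρ hd
    simp only [div_div_div_cancel_right₀ hn'.ne'] at this
    rwa [half_sub_empiricalRisk _ _ _ ((div_pos_iff_of_pos_right hn').1 hA)
      ((div_pos_iff_of_pos_right hn').1 hU)]

end

/-! ### The induced estimator and its precision. -/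

section

variable {X : Type*} {𝒯 : Set ℝ} {n : ℕ}

theorem inducedEstimator_of_isTrimmed (H : Set (X → Bool)) (τ ε : ℕ → ℝ) {S : Fin n → 𝒯 × X}
    {t : 𝒯} (h : IsTrimmed (τ n) S t) :
    inducedEstimator H 𝒯 τ ε n S t = max (plugIn H 𝒯 n S t - ε n) 0 :=
  if_pos h

theorem inducedEstimator_of_not_isTrimmed (H : Set (X → Bool)) (τ ε : ℕ → ℝ)
    {S : Fin n → 𝒯 × X} {t : 𝒯} (h : ¬ IsTrimmed (τ n) S t) :
    inducedEstimator H 𝒯 τ ε n S t = 0 :=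
  if_neg h

theorem inducedEstimator_pos_iff {H : Set (X → Bool)} {τ ε : ℕ → ℝ} {S : Fin n → 𝒯 × X} {t : 𝒯} :
    0 < inducedEstimator H 𝒯 τ ε n S t ↔ IsTrimmed (τ n) S t ∧ ε n < plugIn H 𝒯 n S t := by
  by_cases h : IsTrimmed (τ n) S t
  · rw [inducedEstimator_of_isTrimmed H τ ε h]
    simp [h]
  · rw [inducedEstimator_of_not_isTrimmed H τ ε h]
    simp [h]

theorem inducedEstimator_congr (H : Set (X → Bool)) (τ ε : ℕ → ℝ) {S : Fin n → 𝒯 × X} {t t' : 𝒯}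
    (h : ∀ i, afterLabel t (S i).1 = afterLabel t' (S i).1) :
    inducedEstimator H 𝒯 τ ε n S t = inducedEstimator H 𝒯 τ ε n S t' := by
  simp only [inducedEstimator, labelFreq_congr h, plugIn_congr H h]

/-- The estimator depends on `t` only through the label vector of the window, which takes finitely
many values. -/
theorem exists_isDriftPointEstimate (H : Set (X → Bool)) (τ ε : ℕ → ℝ) [Nonempty 𝒯]
    (S : Fin n → 𝒯 × X) : ∃ t, IsDriftPointEstimate (inducedEstimator H 𝒯 τ ε) S t := by
  let L : 𝒯 → Fin n → Bool := fun t i => afterLabel t (S i).1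
  let v : Set.range L → 𝒯 := fun b => b.2.choose
  have hv : ∀ b, L (v b) = b := fun b => b.2.choose_spec
  obtain ⟨b, hb⟩ := Finite.exists_max fun b : Set.range L => inducedEstimator H 𝒯 τ ε n S (v b)
  refine ⟨v b, fun t => ?_⟩
  rw [← inducedEstimator_congr H τ ε (t := v ⟨L t, t, rfl⟩) (t' := t)
    (fun i => congrFun (hv ⟨L t, t, rfl⟩) i)]
  exact hb _

end

section

variable {X : Type*} [MeasurableSpace X] {𝒯 : Set ℝ}

theorem isPrecise_inducedEstimator {H : Set (X → Bool)} (hne : H.Nonempty)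
    (hH : ∀ h ∈ H, Measurable h) (hmeas : IsEstimator (plugIn H 𝒯)) (hPAC : IsPACLearnable H)
    {τ ε : ℕ → ℝ} (hτ : ∀ n, 0 < τ n) (hε : ∀ n, 0 < ε n)
    (hτ0 : Tendsto τ atTop (𝓝 0)) (hε0 : Tendsto ε atTop (𝓝 0))
    (hrate : Tendsto (fun n : ℕ => ε n * τ n * √((n : ℝ) / Real.log n)) atTop atTop) :
    IsPrecise (inducedEstimator H 𝒯 τ ε) := by
  intro PT _ p _ t₀ hdrift hpos hlt δ ε' hδ _ hε'
  obtain ⟨P, Q, -, hPt, hQt⟩ := hdrift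
  have : Nonempty 𝒯 := ⟨t₀⟩
  have hPprob : IsProbabilityMeasure P := hPt t₀ le_rfl ▸ inferInstance
  have hIoi : 0 < PT (Set.Ioi t₀) := by
    rw [← Set.compl_Iic, prob_compl_eq_one_sub measurableSet_Iic]
    exact tsub_pos_of_lt hlt
  obtain ⟨t₁, ht₁⟩ := nonempty_of_measure_ne_zero hIoi.ne'
  have hQprob : IsProbabilityMeasure Q := hQt t₁ ht₁ ▸ inferInstance
  have hp : ∀ t, p t = if t ≤ t₀ then P else Q := fun t => by
    split_ifs with h
    · exact hPt t h
    · exact hQt t (not_le.1 h)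
  set f : (X → Bool) → ℝ := fun h =>
    1 / 2 * (∫ x, labelValue (h x) ∂Q - ∫ x, labelValue (h x) ∂P) with hf
  have hint : ∀ (ν : Measure X) [IsProbabilityMeasure ν] (h : X → Bool),
      (0 ≤ ∫ x, labelValue (h x) ∂ν) ∧ (∫ x, labelValue (h x) ∂ν) ≤ 1 := by
    intro ν _ h
    refine ⟨integral_nonneg fun x => labelValue_nonneg _, ?_⟩
    have := norm_integral_le_of_norm_le_const (μ := ν) (C := 1) (f := fun x => labelValue (h x))
      (ae_of_all _ fun x => by
        rw [Real.norm_eq_abs, abs_of_nonneg (labelValue_nonneg _)]; exact labelValue_le_one _)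
    simp only [probReal_univ, mul_one] at this
    exact (le_abs_self _).trans this
  have hbdd : BddAbove (Set.range fun h : H => f h) := by
    refine ⟨1, ?_⟩
    rintro _ ⟨h, rfl⟩
    have h1 := hint P h
    have h2 := hint Q h
    simp only [hf]
    linarith
  -- The supremum may be negative when no `h` separates the phases in the right direction.
  set Δ : ℝ := max 0 (⨆ h : H, f h) with hΔ
  have hΔ0 : 0 ≤ Δ := le_max_left _ _
  have hPQ : ∀ h ∈ H, f h ≤ Δ := fun h hh =>
    (le_ciSup hbdd ⟨h, hh⟩).trans (le_max_right _ _)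
  suffices hsuff : ∀ᶠ n : ℕ in atTop, windowLaw PT p n {S | ¬ (Detects
      (inducedEstimator H 𝒯 τ ε) S → (∃ t, IsDriftPointEstimate (inducedEstimator H 𝒯 τ ε) S t) ∧
        ∀ t, IsDriftPointEstimate (inducedEstimator H 𝒯 τ ε) S t → 1 - ε' < precision PT t₀ t)}
      ≤ ENNReal.ofReal δ by
    obtain ⟨n₀, hn₀⟩ := eventually_atTop.1 hsuff
    exact ⟨n₀, fun n hn => hn₀ n hn.le⟩
  rcases hΔ0.eq_or_lt with hΔz | hΔpos
  -- If `Δ = 0`, the required implication fails only when an alarm is raised, and an alarm would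
  -- exceed the upper bound `ε n / 2`.
  · filter_upwards [eventually_windowLaw_lt_plugIn_le (PT := PT) hne hH hmeas hPAC hτ hε hrate hp
      hΔ0 hPQ hδ]
      with n hn
    refine (measure_mono ?_).trans hn
    intro S hS
    simp only [Set.mem_ofPred_eq, Classical.not_imp] at hS
    obtain ⟨t, ht⟩ := hS.1
    obtain ⟨htr, hlt⟩ := inducedEstimator_pos_iff.1 ht
    refine ⟨t, htr, ?_⟩
    rw [← hΔz, mul_zero, zero_add]
    linarith [hε n]
  · have := hne.to_subtype
    -- At a maximizer, `mismatch * Δ < 2 * η + ε n / 2`: one `η` for the choice of `h`, one for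
    -- sampling. With `ε n < Δ * ε' / 4` the right side is below `Δ * ε' / 2`.
    set η := Δ * ε' / 8 with hη
    have hη0 : 0 < η := by positivity
    have hΔsup : Δ = ⨆ h : H, f h := by
      rcases max_choice 0 (⨆ h : H, f h) with h | h
      · rw [← hΔ] at h; exact absurd h hΔpos.ne'
      · exact h
    obtain ⟨⟨h, hh⟩, hfh⟩ := exists_lt_of_lt_ciSup (show Δ - η < ⨆ h : H, f h by
      rw [← hΔsup]; linarith)
    have hIic : 0 < PT.real (Set.Iic t₀) := ENNReal.toReal_pos hpos.ne' (measure_ne_top _ _)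
    have hIoi' : 0 < PT.real (Set.Ioi t₀) := ENNReal.toReal_pos hIoi.ne' (measure_ne_top _ _)
    have hms : MeasurableSet {z : 𝒯 × X | t₀ < z.1} :=
      measurableSet_lt measurable_const measurable_fst
    have hm : Measurable fun z : 𝒯 × X => labelValue (h z.2) :=
      measurable_labelValue.comp ((hH h hh).comp measurable_snd)
    have hbound : ∀ b, ‖labelValue b‖ ≤ 1 := fun b => by
      rw [Real.norm_eq_abs, abs_of_nonneg (labelValue_nonneg b)]; exact labelValue_le_one b
    have hiA : ∀ c : ℝ, ∫ t, (if t₀ < t then c else 0) ∂PT = PT.real (Set.Ioi t₀) * c := by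
      intro c
      have : (fun t => if t₀ < t then c else 0) = (Set.Ioi t₀).indicator fun _ => c := by
        funext t; simp [Set.indicator_apply]
      rw [this, integral_indicator_const _ measurableSet_Ioi, smul_eq_mul]
    have hiU : ∀ c : ℝ, ∫ t, (if t₀ < t then 0 else c) ∂PT = PT.real (Set.Iic t₀) * c := by
      intro c
      have : (fun t => if t₀ < t then 0 else c) = (Set.Iic t₀).indicator fun _ => c := by
        funext t; simp only [Set.indicator_apply, Set.mem_Iic, ← not_lt, ite_not]
      rw [this, integral_indicator_const _ measurableSet_Iic, smul_eq_mul]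
    have hα : ∫ z : 𝒯 × X, (if t₀ < z.1 then (1 : ℝ) else 0) ∂(PT ⊗ₘ p)
        = PT.real (Set.Ioi t₀) := by
      rw [Measure.integral_compProd, ← mul_one (PT.real _), ← hiA]
      · refine integral_congr_ae (ae_of_all _ fun t => ?_)
        by_cases ht : t₀ < t <;> simp [ht]
      · exact Integrable.of_bound
          (Measurable.ite hms measurable_const measurable_const).aestronglyMeasurable 1
          (ae_of_all _ fun z => by split_ifs <;> simp)
    have hβ : ∫ z : 𝒯 × X, (if t₀ < z.1 then (0 : ℝ) else 1) ∂(PT ⊗ₘ p)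
        = PT.real (Set.Iic t₀) := by
      rw [Measure.integral_compProd, ← mul_one (PT.real _), ← hiU]
      · refine integral_congr_ae (ae_of_all _ fun t => ?_)
        by_cases ht : t₀ < t <;> simp [ht]
      · exact Integrable.of_bound
          (Measurable.ite hms measurable_const measurable_const).aestronglyMeasurable 1
          (ae_of_all _ fun z => by split_ifs <;> simp)
    have ha : ∫ z : 𝒯 × X, (if t₀ < z.1 then labelValue (h z.2) else 0) ∂(PT ⊗ₘ p)
        = PT.real (Set.Ioi t₀) * ∫ x, labelValue (h x) ∂Q := by
      rw [Measure.integral_compProd, ← hiA]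
      · refine integral_congr_ae (ae_of_all _ fun t => ?_)
        by_cases ht : t₀ < t
        · simp only [ht, if_true, hQt t ht]
        · simp [ht]
      · exact Integrable.of_bound (Measurable.ite hms hm measurable_const).aestronglyMeasurable 1
          (ae_of_all _ fun z => by split_ifs <;> simp [hbound, -Real.norm_eq_abs])
    have hb : ∫ z : 𝒯 × X, (if t₀ < z.1 then 0 else labelValue (h z.2)) ∂(PT ⊗ₘ p)
        = PT.real (Set.Iic t₀) * ∫ x, labelValue (h x) ∂P := by
      rw [Measure.integral_compProd, ← hiU]
      · refine integral_congr_ae (ae_of_all _ fun t => ?_)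
        by_cases ht : t₀ < t
        · simp [ht]
        · simp only [ht, if_false, hPt t (not_lt.1 ht)]
      · exact Integrable.of_bound (Measurable.ite hms measurable_const hm).aestronglyMeasurable 1
          (ae_of_all _ fun z => by split_ifs <;> simp [hbound, -Real.norm_eq_abs])
    have hδ3 : 0 < δ / 3 := by positivity
    filter_upwards [
      eventually_windowLaw_lt_plugIn_le (PT := PT) hne hH hmeas hPAC hτ hε hrate hp hΔ0 hPQ hδ3,
      eventually_windowLaw_mismatch_lt_le PT p t₀ hε' hδ3,
      eventually_windowLaw_risk_le hτ0 PT p t₀ (hH h hh) hIoi' hIic hα hβ ha hb hη0 hδ3,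
      hε0.eventually (gt_mem_nhds (show 0 < Δ * ε' / 4 by positivity))] with n h1 h2 h3 hεn
    have hsum : ENNReal.ofReal δ = ENNReal.ofReal (δ / 3) + ENNReal.ofReal (δ / 3)
        + ENNReal.ofReal (δ / 3) := by
      rw [← ENNReal.ofReal_add (by positivity) (by positivity),
        ← ENNReal.ofReal_add (by positivity) (by positivity)]
      congr 1; ring
    rw [hsum]
    refine (measure_mono ?_).trans ((measure_union_le _ _).trans (add_le_add
      ((measure_union_le _ _).trans (add_le_add h1 h2)) h3))
    intro S hS
    by_contra hcon
    simp only [Set.mem_union, Set.mem_ofPred_eq, not_or] at hcon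
    obtain ⟨⟨k1, k2⟩, k34⟩ := hcon
    obtain ⟨k3, k4⟩ := not_not.1 k34
    simp only [not_exists, not_and, not_lt] at k1 k2
    refine hS fun ⟨t', ht'⟩ => ⟨exists_isDriftPointEstimate H τ ε S, fun t ht => ?_⟩
    -- The alarm makes the maximum positive, so a maximizer is trimmed and the upper bound applies
    -- to it.
    obtain ⟨htr, hεt⟩ := inducedEstimator_pos_iff.1 (ht'.trans_le (ht t'))
    have hval : inducedEstimator H 𝒯 τ ε n S t = plugIn H 𝒯 n S t - ε n := by
      rw [inducedEstimator_of_isTrimmed H τ ε htr, max_eq_left (by linarith)]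
    have hval0 : plugIn H 𝒯 n S t₀ - ε n ≤ inducedEstimator H 𝒯 τ ε n S t₀ := by
      rw [inducedEstimator_of_isTrimmed H τ ε k3]
      exact le_max_left _ _
    have h0 : 1 / 2 - empiricalRisk S t₀ h ≤ plugIn H 𝒯 n S t₀ :=
      (plugIn_le_iff hne S t₀ _).1 le_rfl h hh
    have hmax := ht t₀
    have hup := k1 t htr
    rw [mul_div_cancel_left₀ _ hIoi'.ne', mul_div_cancel_left₀ _ hIic.ne'] at k4
    have hfh' : Δ - η < 1 / 2 * (∫ x, labelValue (h x) ∂Q - ∫ x, labelValue (h x) ∂P) := hfh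
    have hmm : mismatch S t₀ t < ε' / 2 := by
      refine lt_of_mul_lt_mul_right ?_ hΔ0
      linarith
    rw [precision]
    by_contra hcc
    push Not at hcc
    exact absurd hmm (not_lt.2 (k2 t (by linarith)))

end

/-! ### Dependence of time and observation, and alarms. -/

section

/-- The measurable sets of arrival times are generated by the splits. -/
theorem measurableSpace_eq_generateFrom_Ioi (𝒯 : Set ℝ) :
    (inferInstance : MeasurableSpace 𝒯) = MeasurableSpace.generateFrom (Set.range Set.Ioi) := by
  apply le_antisymm
  · show Subtype.instMeasurableSpace ≤ _
    rw [Subtype.instMeasurableSpace, BorelSpace.measurable_eq (α := ℝ), borel_eq_generateFrom_Ioi,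
      MeasurableSpace.comap_generateFrom]
    refine MeasurableSpace.generateFrom_le ?_
    rintro _ ⟨_, ⟨r, rfl⟩, rfl⟩
    rw [← MeasurableSet.compl_iff]
    -- The threshold `r` need not lie in `𝒯`, so the initial segment `V` is exhausted by countably
    -- many segments with endpoints in `𝒯`.
    set V : Set 𝒯 := (Subtype.val ⁻¹' Set.Ioi r)ᶜ with hV
    set m := MeasurableSpace.generateFrom (Set.range (Set.Ioi : 𝒯 → Set 𝒯)) with hm
    have hIic : ∀ t : 𝒯, MeasurableSet[m] (Set.Iic t) := fun t => by
      rw [← Set.compl_Ioi]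
      exact m.measurableSet_compl _
        (MeasurableSpace.measurableSet_generateFrom (Set.mem_range_self t))
    rcases V.eq_empty_or_nonempty with hVe | hVn
    · rw [hVe]; exact m.measurableSet_empty
    · obtain ⟨u, huV, hu⟩ := exists_cofinal_seq_of_nonempty hVn
      have : V = ⋃ k, Set.Iic (u k) := by
        ext t
        simp only [Set.mem_iUnion, Set.mem_Iic]
        refine ⟨hu t, fun ⟨k, hk⟩ => ?_⟩
        have h1 : (u k : ℝ) ≤ r := not_lt.1 (huV k)
        exact not_lt.2 ((Subtype.coe_le_coe.2 hk).trans h1)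
      rw [this]
      exact m.measurableSet_iUnion _ fun k => hIic _
  · refine MeasurableSpace.generateFrom_le ?_
    rintro _ ⟨t, rfl⟩
    exact measurableSet_Ioi

variable {X : Type*} [MeasurableSpace X] {𝒯 : Set ℝ}

/-- The joint law of the observation and the label of its arrival time for the split at `t`. -/
noncomputable def labelledLaw (μ : Measure (𝒯 × X)) (t : 𝒯) : Measure (X × Bool) :=
  μ.map fun z => (z.2, afterLabel t z.1)

theorem measurable_labelled (t : 𝒯) : Measurable fun z : 𝒯 × X => (z.2, afterLabel t z.1) :=
  measurable_snd.prodMk (measurable_afterLabel.comp (measurable_const.prodMk measurable_fst))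

instance (μ : Measure (𝒯 × X)) [IsProbabilityMeasure μ] (t : 𝒯) :
    IsProbabilityMeasure (labelledLaw μ t) :=
  Measure.isProbabilityMeasure_map (measurable_labelled t).aemeasurable

/-- If the observations are independent of the labels of all splits, then they are independent of
the arrival times. -/
theorem eq_prod_of_forall_indepFun (μ : Measure (𝒯 × X)) [IsProbabilityMeasure μ]
    (h : ∀ t, IndepFun (Prod.fst : X × Bool → X) (Prod.snd : X × Bool → Bool) (labelledLaw μ t)) :
    μ = μ.fst.prod μ.snd := by
  refine (Measure.prod_eq fun B A hB hA => ?_).symm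
  set ν₁ : Measure 𝒯 := (μ.restrict (Prod.snd ⁻¹' A)).map Prod.fst with hν₁
  set ν₂ : Measure 𝒯 := μ.snd A • μ.fst with hν₂
  have hν₁a : ∀ C, MeasurableSet C → ν₁ C = μ (C ×ˢ A) := fun C hC => by
    rw [hν₁, Measure.map_apply measurable_fst hC, Measure.restrict_apply (measurable_fst hC)]
    rfl
  have hfin : IsFiniteMeasure ν₂ := Measure.smul_finite _ (measure_ne_top _ _)
  have heq : ν₁ = ν₂ := by
    refine ext_of_generate_finite _ (measurableSpace_eq_generateFrom_Ioi 𝒯) isPiSystem_Ioi ?_ ?_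
    · rintro _ ⟨t, rfl⟩
      have hi := (h t).measure_inter_preimage_eq_mul A {true} hA (measurableSet_singleton _)
      have hl := measurable_labelled (X := X) t
      rw [labelledLaw, Measure.map_apply hl ((measurable_fst hA).inter
          (measurable_snd (measurableSet_singleton _))), Measure.map_apply hl (measurable_fst hA),
        Measure.map_apply hl (measurable_snd (measurableSet_singleton _))] at hi
      rw [hν₁a _ measurableSet_Ioi, hν₂, Measure.smul_apply, smul_eq_mul,
        Measure.snd_apply hA, Measure.fst_apply measurableSet_Ioi]
      have e1 : (fun z : 𝒯 × X => (z.2, afterLabel t z.1)) ⁻¹'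
          (Prod.fst ⁻¹' A ∩ Prod.snd ⁻¹' {true}) = Set.Ioi t ×ˢ A := by
        ext z; simp [afterLabel, and_comm]
      have e2 : (fun z : 𝒯 × X => (z.2, afterLabel t z.1)) ⁻¹' (Prod.snd ⁻¹' {true})
          = Prod.fst ⁻¹' Set.Ioi t := by
        ext z; simp [afterLabel]
      rw [e1, e2] at hi
      exact hi
    · rw [hν₁a _ MeasurableSet.univ, hν₂, Measure.smul_apply, smul_eq_mul, measure_univ, mul_one,
        Measure.snd_apply hA, Set.univ_prod]
  rw [← hν₁a B hB, heq, hν₂, Measure.smul_apply, smul_eq_mul, mul_comm]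

theorem measurableSet_label_eq (b : Bool) : MeasurableSet {w : X × Bool | w.2 = b} :=
  measurable_snd (measurableSet_singleton b)

/-- The population counterpart of `half_sub_empiricalRisk`, with the parameters of
`eventually_windowLaw_risk_le`, so that the law of large numbers transfers a risk below `1/2` to the
window. -/
theorem weightedRisk_labelledLaw (μ : Measure (𝒯 × X)) [IsProbabilityMeasure μ] (t : 𝒯)
    {h : X → Bool} (hh : Measurable h) {α β a b : ℝ} (hα0 : 0 < α) (hβ0 : 0 < β)
    (hα : ∫ z : 𝒯 × X, (if t < z.1 then 1 else 0) ∂μ = α)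
    (hβ : ∫ z : 𝒯 × X, (if t < z.1 then 0 else 1) ∂μ = β)
    (ha : ∫ z : 𝒯 × X, (if t < z.1 then labelValue (h z.2) else 0) ∂μ = a)
    (hb : ∫ z : 𝒯 × X, (if t < z.1 then 0 else labelValue (h z.2)) ∂μ = b) :
    weightedRisk (labelledLaw μ t) h = 1 / 2 - 1 / 2 * (a / α - b / β) := by
  have hl := measurable_labelled (X := X) t
  have hms : MeasurableSet {z : 𝒯 × X | t < z.1} := measurableSet_lt measurable_const measurable_fst
  have hm : Measurable fun z : 𝒯 × X => labelValue (h z.2) :=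
    measurable_labelValue.comp (hh.comp measurable_snd)
  have hlv : ∀ b, ‖labelValue b‖ ≤ 1 := fun b => by
    rw [Real.norm_eq_abs, abs_of_nonneg (labelValue_nonneg b)]; exact labelValue_le_one b
  have htrue : (labelledLaw μ t).real {w | w.2 = true} = α := by
    rw [← hα, labelledLaw, map_measureReal_apply hl (measurableSet_label_eq true),
      ← integral_indicator_one (hl (measurableSet_label_eq true))]
    refine integral_congr_ae (ae_of_all _ fun z => ?_)
    by_cases hz : t < z.1 <;> simp [afterLabel, hz]
  have hfalse : (labelledLaw μ t).real {w | w.2 = false} = β := by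
    rw [← hβ, labelledLaw, map_measureReal_apply hl (measurableSet_label_eq false),
      ← integral_indicator_one (hl (measurableSet_label_eq false))]
    refine integral_congr_ae (ae_of_all _ fun z => ?_)
    by_cases hz : t < z.1 <;> simp [Set.indicator_apply, afterLabel, hz]
  set w : Bool → ℝ := fun y => (labelledLaw μ t).real {w | w.2 = y} with hw
  have hloss : Measurable fun z : X × Bool => weightedLoss w (h z.1) z.2 :=
    (measurable_of_finite fun q : Bool × Bool => weightedLoss w q.1 q.2).comp
      ((hh.comp measurable_fst).prodMk measurable_snd)
  have i1 : Integrable (fun z : 𝒯 × X => if t < z.1 then (1 : ℝ) else 0) μ :=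
    Integrable.of_bound (Measurable.ite hms measurable_const measurable_const).aestronglyMeasurable 1
      (ae_of_all _ fun z => by split_ifs <;> simp)
  have i2 : Integrable (fun z : 𝒯 × X => if t < z.1 then labelValue (h z.2) else 0) μ :=
    Integrable.of_bound (Measurable.ite hms hm measurable_const).aestronglyMeasurable 1
      (ae_of_all _ fun z => by split_ifs <;> simp [hlv, -Real.norm_eq_abs])
  have i3 : Integrable (fun z : 𝒯 × X => if t < z.1 then 0 else labelValue (h z.2)) μ :=
    Integrable.of_bound (Measurable.ite hms measurable_const hm).aestronglyMeasurable 1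
      (ae_of_all _ fun z => by split_ifs <;> simp [hlv, -Real.norm_eq_abs])
  have e : ∀ z : 𝒯 × X, weightedLoss w (h z.2) (afterLabel t z.1)
      = ((if t < z.1 then 1 else 0) - if t < z.1 then labelValue (h z.2) else 0) * (1 / (2 * α))
        + (if t < z.1 then 0 else labelValue (h z.2)) * (1 / (2 * β)) := by
    intro z
    by_cases hz : t < z.1
    · cases h z.2 <;> simp [weightedLoss, afterLabel, hz, labelValue, hw, htrue]
    · cases h z.2 <;> simp [weightedLoss, afterLabel, hz, labelValue, hw, hfalse]
  calc weightedRisk (labelledLaw μ t) h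
      = ∫ z, weightedLoss w (h z.1) z.2 ∂(μ.map fun z => (z.2, afterLabel t z.1)) := rfl
    _ = ∫ z : 𝒯 × X, weightedLoss w (h z.2) (afterLabel t z.1) ∂μ :=
        integral_map hl.aemeasurable hloss.aestronglyMeasurable
    _ = (α - a) * (1 / (2 * α)) + b * (1 / (2 * β)) := by
        simp only [e]
        have i12 : Integrable (fun z : 𝒯 × X => (if t < z.1 then (1 : ℝ) else 0)
            - if t < z.1 then labelValue (h z.2) else 0) μ := i1.sub i2
        rw [integral_add (i12.mul_const _) (i3.mul_const _), integral_mul_const,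
          integral_mul_const, integral_sub i1 i2, hα, ha, hb]
    _ = _ := by field_simp; ring

/-- A label that misses one value is almost surely constant. Hence dependence guarantees that both
class probabilities, which are denominators, are positive. -/
theorem indepFun_labelledLaw_of_measure_eq_zero (μ : Measure (𝒯 × X)) [IsProbabilityMeasure μ]
    (t : 𝒯) (b : Bool) (hb : μ {z | afterLabel t z.1 = b} = 0) :
    IndepFun (Prod.fst : X × Bool → X) (Prod.snd : X × Bool → Bool) (labelledLaw μ t) := by
  have hae : (Prod.snd : X × Bool → Bool) =ᵐ[labelledLaw μ t] fun _ => !b := by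
    have : labelledLaw μ t {w | w.2 = b} = 0 := by
      rw [labelledLaw, Measure.map_apply (measurable_labelled t)
        (measurableSet_label_eq b)]
      exact hb
    filter_upwards [measure_eq_zero_iff_ae_notMem.1 this] with w hw
    exact Bool.eq_not_iff.2 hw
  exact (indepFun_const_right Prod.fst (!b)).congr (ae_eq_refl _) hae.symm

/-- If the observations depend on the arrival times, then an alarm is raised with high
probability. -/
theorem eventually_windowLaw_not_detects_le {H : Set (X → Bool)} (hne : H.Nonempty)
    (hH : ∀ h ∈ H, Measurable h) {τ ε : ℕ → ℝ}
    (hτ0 : Tendsto τ atTop (𝓝 0)) (hε0 : Tendsto ε atTop (𝓝 0)) (hBR : BetterThanRandom H)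
    (PT : Measure 𝒯) [IsProbabilityMeasure PT] (p : Kernel 𝒯 X) [IsMarkovKernel p]
    (hdep : PT ⊗ₘ p ≠ (PT ⊗ₘ p).fst.prod (PT ⊗ₘ p).snd) {δ : ℝ} (hδ : 0 < δ) :
    ∀ᶠ n : ℕ in atTop, windowLaw PT p n {S | ¬ Detects (inducedEstimator H 𝒯 τ ε) S}
      ≤ ENNReal.ofReal δ := by
  set μ := PT ⊗ₘ p with hμ
  obtain ⟨t, ht⟩ : ∃ t, ¬ IndepFun (Prod.fst : X × Bool → X) (Prod.snd : X × Bool → Bool)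
      (labelledLaw μ t) := by
    by_contra! hcon
    exact hdep (eq_prod_of_forall_indepFun μ hcon)
  obtain ⟨h, hh, hrisk⟩ := hBR (labelledLaw μ t) ht
  have hms : ∀ b, MeasurableSet {z : 𝒯 × X | afterLabel t z.1 = b} := fun b =>
    measurable_snd.comp (measurable_labelled t) (measurableSet_singleton b)
  have hpos : ∀ b, 0 < μ.real {z : 𝒯 × X | afterLabel t z.1 = b} := fun b =>
    ENNReal.toReal_pos (fun hb => ht (indepFun_labelledLaw_of_measure_eq_zero μ t b hb))
      (measure_ne_top _ _)
  have hα : ∫ z : 𝒯 × X, (if t < z.1 then (1 : ℝ) else 0) ∂μ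
      = μ.real {z : 𝒯 × X | afterLabel t z.1 = true} := by
    rw [← integral_indicator_one (hms true)]
    refine integral_congr_ae (ae_of_all _ fun z => ?_)
    by_cases hz : t < z.1 <;> simp [afterLabel, hz]
  have hβ : ∫ z : 𝒯 × X, (if t < z.1 then (0 : ℝ) else 1) ∂μ
      = μ.real {z : 𝒯 × X | afterLabel t z.1 = false} := by
    rw [← integral_indicator_one (hms false)]
    refine integral_congr_ae (ae_of_all _ fun z => ?_)
    by_cases hz : t < z.1 <;> simp [Set.indicator_apply, afterLabel, hz]
  rw [weightedRisk_labelledLaw μ t (hH h hh) (hpos true) (hpos false) hα hβ rfl rfl] at hrisk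
  set L := 1 / 2 * ((∫ z : 𝒯 × X, (if t < z.1 then labelValue (h z.2) else 0) ∂μ)
      / μ.real {z : 𝒯 × X | afterLabel t z.1 = true}
    - (∫ z : 𝒯 × X, (if t < z.1 then 0 else labelValue (h z.2)) ∂μ)
      / μ.real {z : 𝒯 × X | afterLabel t z.1 = false}) with hL
  have hL0 : 0 < L := by linarith
  filter_upwards [eventually_windowLaw_risk_le hτ0 PT p t (hH h hh) (hpos true) (hpos false) hα hβ
    rfl rfl (half_pos hL0) hδ, hε0.eventually (gt_mem_nhds (half_pos hL0))] with n hn hεn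
  refine (measure_mono ?_).trans hn
  intro S hS hgood
  refine hS ⟨t, inducedEstimator_pos_iff.2 ⟨hgood.1, ?_⟩⟩
  refine (lt_plugIn_iff hne _ _ _).2 ⟨h, hh, ?_⟩
  have := hgood.2
  rw [← hL] at this
  linarith

/-- If the observations do not depend on the arrival times, then no alarm is raised with high
probability. -/
theorem eventually_windowLaw_detects_le {H : Set (X → Bool)} (hne : H.Nonempty)
    (hH : ∀ h ∈ H, Measurable h) (hmeas : IsEstimator (plugIn H 𝒯)) (hPAC : IsPACLearnable H)
    {τ ε : ℕ → ℝ} (hτ : ∀ n, 0 < τ n) (hε : ∀ n, 0 < ε n)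
    (hrate : Tendsto (fun n : ℕ => ε n * τ n * √((n : ℝ) / Real.log n)) atTop atTop)
    (PT : Measure 𝒯) [IsProbabilityMeasure PT] (P : Measure X) [IsProbabilityMeasure P]
    {δ : ℝ} (hδ : 0 < δ) :
    ∀ᶠ n : ℕ in atTop, windowLaw PT (Kernel.const 𝒯 P) n
      {S | Detects (inducedEstimator H 𝒯 τ ε) S} ≤ ENNReal.ofReal δ := by
  obtain ⟨t₀⟩ := nonempty_of_isProbabilityMeasure PT
  filter_upwards [eventually_windowLaw_lt_plugIn_le (PT := PT) (p := Kernel.const 𝒯 P) (P := P)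
    (Q := P) (t₀ := t₀) hne hH hmeas hPAC hτ hε hrate (fun t => by simp) le_rfl
    (fun h _ => by simp) hδ] with n hn
  refine (measure_mono ?_).trans hn
  rintro S ⟨t, ht⟩
  obtain ⟨htr, hlt⟩ := inducedEstimator_pos_iff.1 ht
  refine ⟨t, htr, ?_⟩
  rw [mul_zero, zero_add]
  linarith [hε n]

/-- An alarm at any split is also raised at an arrival time. Measurability of this event allows
comparing its probability under different processes. -/
theorem measurableSet_detects {H : Set (X → Bool)} (hmeas : IsEstimator (plugIn H 𝒯))
    {τ ε : ℕ → ℝ} (hτ : ∀ n, 0 < τ n) (n : ℕ) :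
    MeasurableSet {S : Fin n → 𝒯 × X | Detects (inducedEstimator H 𝒯 τ ε) S} := by
  have : {S : Fin n → 𝒯 × X | Detects (inducedEstimator H 𝒯 τ ε) S}
      = ⋃ j, {S | 0 < inducedEstimator H 𝒯 τ ε n S (S j).1} := by
    ext S
    simp only [Set.mem_iUnion, Set.mem_ofPred_eq]
    refine ⟨fun ⟨t, ht⟩ => ?_, fun ⟨j, hj⟩ => ⟨_, hj⟩⟩
    have htr := (inducedEstimator_pos_iff.1 ht).1
    obtain ⟨j, hj⟩ := exists_afterLabel_eq
      ((mul_pos (htr.size_pos (hτ n)) (hτ n)).trans_le (htr.le_numUpTo (hτ n)))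
    exact ⟨j, by rwa [← inducedEstimator_congr H τ ε hj]⟩
  rw [this]
  refine MeasurableSet.iUnion fun j => measurableSet_lt measurable_const ?_
  exact (isEstimator_inducedEstimator hmeas τ ε).measurable_comp measurable_id
    (measurable_fst.comp (measurable_pi_apply j))

/-! ### Processes on two times, and sure drift detection. -/

/-- The uniform distribution on the two times `z.1` and `z.2`. -/
noncomputable def twoTimes (z : 𝒯 × 𝒯) : Measure 𝒯 :=
  (2 : ℝ≥0∞)⁻¹ • (Measure.dirac z.1 + Measure.dirac z.2)

instance (z : 𝒯 × 𝒯) : IsProbabilityMeasure (twoTimes z) :=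
  ⟨by simp [twoTimes, ENNReal.inv_two_add_inv_two]⟩

theorem twoTimes_compProd_apply (z : 𝒯 × 𝒯) (p : Kernel 𝒯 X) [IsMarkovKernel p]
    {B : Set (𝒯 × X)} (hB : MeasurableSet B) : (twoTimes z ⊗ₘ p) B
      = 2⁻¹ * (p z.1 (Prod.mk z.1 ⁻¹' B) + p z.2 (Prod.mk z.2 ⁻¹' B)) := by
  have hm := Kernel.measurable_kernel_prodMk_left (κ := p) hB
  rw [Measure.compProd_apply hB, twoTimes, lintegral_smul_measure, lintegral_add_measure,
    lintegral_dirac' _ hm, lintegral_dirac' _ hm, smul_eq_mul]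

/-- If the joint laws of two kernels agree, then the conditional probabilities of every event agree
at almost all times. -/
theorem ae_kernel_apply_eq_of_compProd_eq {PT : Measure 𝒯} [IsProbabilityMeasure PT] {p q : Kernel 𝒯 X}
    [IsMarkovKernel p] [IsMarkovKernel q] (h : PT ⊗ₘ p = PT ⊗ₘ q) {B : Set (𝒯 × X)}
    (hB : MeasurableSet B) :
    ∀ᵐ t ∂PT, p t (Prod.mk t ⁻¹' B) = q t (Prod.mk t ⁻¹' B) := by
  have key : ∀ (r : Kernel 𝒯 X) [IsMarkovKernel r] (C : Set 𝒯), MeasurableSet C →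
      ∫⁻ t in C, r t (Prod.mk t ⁻¹' B) ∂PT = (PT ⊗ₘ r) (B ∩ Prod.fst ⁻¹' C) := by
    intro r _ C hC
    rw [Measure.compProd_apply (hB.inter (measurable_fst hC)), ← lintegral_indicator hC]
    refine lintegral_congr fun t => ?_
    by_cases ht : t ∈ C
    · rw [Set.indicator_of_mem ht]
      congr 1
      ext x; simp [ht]
    · rw [Set.indicator_of_notMem ht]
      symm
      convert measure_empty (μ := r t)
      ext x; simp [ht]
  refine ae_eq_of_forall_setLIntegral_eq_of_sigmaFinite
    (Kernel.measurable_kernel_prodMk_left hB) (Kernel.measurable_kernel_prodMk_left hB) ?_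
  intro C hC _
  rw [key p C hC, key q C hC, h]

/-- For a measure with two atoms, an almost sure identity holds at both atoms whatever the event `A`
is, so no countable generator of the σ-algebra on `X` is needed. -/
theorem apply_eq_of_twoTimes_compProd_eq {z : 𝒯 × 𝒯} {p : Kernel 𝒯 X} [IsMarkovKernel p]
    {P : Measure X} [IsProbabilityMeasure P]
    (h : twoTimes z ⊗ₘ p = twoTimes z ⊗ₘ Kernel.const 𝒯 P) : p z.1 = p z.2 := by
  refine Measure.ext fun A hA => ?_
  have hall : ∀ᵐ t ∂(twoTimes z), p t A = P A :=
    ae_kernel_apply_eq_of_compProd_eq h (B := Prod.snd ⁻¹' A) (measurable_snd hA)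
  have hset : MeasurableSet {t | ¬ p t A = P A} :=
    (measurableSet_eq_fun (p.measurable_coe hA) measurable_const).compl
  rw [ae_iff, twoTimes] at hall
  simp only [Measure.smul_apply, Measure.add_apply, smul_eq_mul, mul_eq_zero,
    ENNReal.inv_eq_zero, ENNReal.ofNat_ne_top, false_or, add_eq_zero] at hall
  have hdir : ∀ t : 𝒯, Measure.dirac t {t | ¬ p t A = P A} = 0 → p t A = P A := fun t ht => by
    rw [Measure.dirac_apply' _ hset] at ht
    simpa [Set.indicator_apply] using ht
  rw [hdir _ hall.1, hdir _ hall.2]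

/-- If the joint laws of two kernels agree, then at almost all pairs of times, the windows with
these two arrival times have the same law on any given event. -/
theorem ae_windowLaw_twoTimes_eq {PT : Measure 𝒯} [IsProbabilityMeasure PT] {p q : Kernel 𝒯 X}
    [IsMarkovKernel p] [IsMarkovKernel q] (h : PT ⊗ₘ p = PT ⊗ₘ q) {n : ℕ}
    {E : Set (Fin n → 𝒯 × X)} (hE : MeasurableSet E) :
    ∀ᵐ z ∂(PT.prod PT), windowLaw (twoTimes z) p n E = windowLaw (twoTimes z) q n E := by
  have hprob : ∀ (z : 𝒯 × 𝒯) (r : Kernel 𝒯 X) [IsMarkovKernel r],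
      IsProbabilityMeasure (windowLaw (twoTimes z) r n) := fun z r _ => by
    unfold windowLaw; infer_instance
  refine MeasurableSpace.induction_on_inter (C := fun E _ => ∀ᵐ z ∂(PT.prod PT),
    windowLaw (twoTimes z) p n E = windowLaw (twoTimes z) q n E) generateFrom_pi.symm isPiSystem_pi
    ?_ ?_ ?_ ?_ E hE
  · simp
  · rintro _ ⟨B, hB, rfl⟩
    have hB' : ∀ i, MeasurableSet (B i) := fun i => hB i (Set.mem_univ i)
    have h1 : ∀ᵐ z ∂(PT.prod PT), ∀ i,
        p z.1 (Prod.mk z.1 ⁻¹' B i) = q z.1 (Prod.mk z.1 ⁻¹' B i) :=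
      Measure.quasiMeasurePreserving_fst.ae (ae_all_iff.2 fun i => ae_kernel_apply_eq_of_compProd_eq h (hB' i))
    have h2 : ∀ᵐ z ∂(PT.prod PT), ∀ i,
        p z.2 (Prod.mk z.2 ⁻¹' B i) = q z.2 (Prod.mk z.2 ⁻¹' B i) :=
      Measure.quasiMeasurePreserving_snd.ae (ae_all_iff.2 fun i => ae_kernel_apply_eq_of_compProd_eq h (hB' i))
    filter_upwards [h1, h2] with z k1 k2
    simp only [windowLaw, Measure.pi_pi, twoTimes_compProd_apply _ _ (hB' _), k1, k2]
  · intro F hF hz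
    filter_upwards [hz] with z hz
    rw [prob_compl_eq_one_sub hF, prob_compl_eq_one_sub hF, hz]
  · intro F hdisj hF hz
    filter_upwards [ae_all_iff.2 hz] with z hz
    rw [measure_iUnion hdisj hF, measure_iUnion hdisj hF]
    exact tsum_congr hz

/-- Drift has to imply dependence of time and observation. For each measurable event, independence
yields agreement only off a null set of times, but only countably many events matter here: the
alarms, one for each window size. -/
theorem isSurelyDriftDetecting_inducedEstimator {H : Set (X → Bool)} (hne : H.Nonempty)
    (hH : ∀ h ∈ H, Measurable h) (hmeas : IsEstimator (plugIn H 𝒯)) (hPAC : IsPACLearnable H)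
    {τ ε : ℕ → ℝ} (hτ : ∀ n, 0 < τ n) (hε : ∀ n, 0 < ε n)
    (hτ0 : Tendsto τ atTop (𝓝 0)) (hε0 : Tendsto ε atTop (𝓝 0))
    (hrate : Tendsto (fun n : ℕ => ε n * τ n * √((n : ℝ) / Real.log n)) atTop atTop)
    (hBR : BetterThanRandom H) : IsSurelyDriftDetecting (inducedEstimator H 𝒯 τ ε) := by
  intro PT _ p _ δ hδ _
  suffices hsuff : ∀ᶠ n : ℕ in atTop, windowLaw PT p n
      {S | ¬ (Detects (inducedEstimator H 𝒯 τ ε) S ↔ HasDrift PT p)} ≤ ENNReal.ofReal δ by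
    obtain ⟨n₀, hn₀⟩ := eventually_atTop.1 hsuff
    exact ⟨n₀, fun n hn => hn₀ n hn.le⟩
  by_cases hdrift : HasDrift PT p
  · simp only [hdrift, iff_true]
    refine eventually_windowLaw_not_detects_le hne hH hτ0 hε0 hBR PT p (fun hindep => ?_) hδ
    have hsndprob : IsProbabilityMeasure (PT ⊗ₘ p).snd := inferInstance
    set P := (PT ⊗ₘ p).snd with hP
    rw [Measure.fst_compProd, ← Measure.compProd_const] at hindep
    have hae : ∀ᵐ z ∂(PT.prod PT), ∀ n : ℕ,
        windowLaw (twoTimes z) p n {S | Detects (inducedEstimator H 𝒯 τ ε) S}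
        = windowLaw (twoTimes z) (Kernel.const 𝒯 P) n
            {S | Detects (inducedEstimator H 𝒯 τ ε) S} :=
      ae_all_iff.2 fun n => ae_windowLaw_twoTimes_eq hindep (measurableSet_detects hmeas hτ n)
    obtain ⟨z, hz, hzae⟩ : ∃ z : 𝒯 × 𝒯, p z.1 ≠ p z.2 ∧ ∀ n : ℕ,
        windowLaw (twoTimes z) p n {S | Detects (inducedEstimator H 𝒯 τ ε) S}
        = windowLaw (twoTimes z) (Kernel.const 𝒯 P) n
            {S | Detects (inducedEstimator H 𝒯 τ ε) S} := by
      by_contra! hcon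
      -- The set of pairs with `p z.1 ≠ p z.2` need not be measurable; positive outer measure
      -- already prevents it from lying in a null set.
      refine hdrift.ne' (measure_mono_null (fun z hz => ?_) (ae_iff.1 hae))
      obtain ⟨n, hn⟩ := hcon z hz
      exact fun hall => hn (hall n)
    have hdep : twoTimes z ⊗ₘ p ≠ (twoTimes z ⊗ₘ p).fst.prod (twoTimes z ⊗ₘ p).snd := by
      intro heq
      rw [Measure.fst_compProd, ← Measure.compProd_const] at heq
      exact hz (apply_eq_of_twoTimes_compProd_eq heq)
    -- At a common window size, the alarm event and its complement would both have probability at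
    -- most `1/3`, but the two probabilities sum to `1`.
    have h3 : (0 : ℝ) < 1 / 3 := by norm_num
    obtain ⟨n, h1, h2⟩ := ((eventually_windowLaw_not_detects_le hne hH hτ0 hε0 hBR (twoTimes z) p
      hdep h3).and (eventually_windowLaw_detects_le hne hH hmeas hPAC hτ hε hrate (twoTimes z) P
      h3)).exists
    rw [← hzae n] at h2
    have hprob : IsProbabilityMeasure (windowLaw (twoTimes z) p n) := by
      unfold windowLaw; infer_instance
    have hsum := prob_add_prob_compl (μ := windowLaw (twoTimes z) p n)
      (measurableSet_detects (ε := ε) hmeas hτ n)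
    have hle := add_le_add h2 h1
    rw [← ENNReal.ofReal_add h3.le h3.le] at hle
    refine absurd (hsum.ge.trans hle) (not_le.2 ?_)
    rw [← ENNReal.ofReal_one]
    exact (ENNReal.ofReal_lt_ofReal_iff one_pos).2 (by norm_num)
  · simp only [hdrift, iff_false, not_not]
    have h0 : ∀ᵐ z ∂(PT.prod PT), p z.1 = p z.2 := by
      rw [ae_iff]
      simpa [HasDrift] using hdrift
    -- Some `p s` agrees with `p t` for almost every `t`, so the windows have the law of a constant
    -- kernel.
    obtain ⟨s, hs⟩ := (Measure.ae_ae_of_ae_prod h0).exists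
    have hlaw : PT ⊗ₘ p = PT ⊗ₘ Kernel.const 𝒯 (p s) :=
      Measure.compProd_congr (by filter_upwards [hs] with t ht; simpa using ht.symm)
    have hw : ∀ n, windowLaw PT p n = windowLaw PT (Kernel.const 𝒯 (p s)) n := fun n => by
      simp only [windowLaw, hlaw]
    simp only [hw]
    exact eventually_windowLaw_detects_le hne hH hmeas hPAC hτ hε hrate PT (p s) hδ

end

end DriftDetection

theorem mainTheorem2 {X : Type*} [MeasurableSpace X] (𝒯 : Set ℝ)
    (H : Set (X → Bool)) (hne : H.Nonempty) (hH : ∀ h ∈ H, Measurable h)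
    (hmeas : DriftDetection.IsEstimator (DriftDetection.plugIn H 𝒯))
    (τ ε : ℕ → ℝ) (hτ : ∀ n, 0 < τ n) (hε : ∀ n, 0 < ε n)
    (hτ0 : Tendsto τ atTop (𝓝 0)) (hε0 : Tendsto ε atTop (𝓝 0))
    (hrate : Tendsto (fun n : ℕ => ε n * τ n * √((n : ℝ) / Real.log n)) atTop atTop)
    (hPAC : DriftDetection.IsPACLearnable H) :
    DriftDetection.IsEstimator (DriftDetection.inducedEstimator H 𝒯 τ ε) ∧
    DriftDetection.IsPrecise (DriftDetection.inducedEstimator H 𝒯 τ ε) ∧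
    (DriftDetection.BetterThanRandom H →
      DriftDetection.IsSurelyDriftDetecting (DriftDetection.inducedEstimator H 𝒯 τ ε)) :=
  ⟨DriftDetection.isEstimator_inducedEstimator hmeas τ ε,
    DriftDetection.isPrecise_inducedEstimator hne hH hmeas hPAC hτ hε hτ0 hε0 hrate,
    DriftDetection.isSurelyDriftDetecting_inducedEstimator hne hH hmeas hPAC hτ hε hτ0 hε0 hrate⟩
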